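/- Let $\omega(x,y)=8-2\cos x-2\cos y-2\cos(x+y)-2\cos(x-y)$ and, for $p=(x_0,y_0)\in[0,2\pi]^2$, let $\Phi_p(x,y)=\omega(x,y)-(x,y)\cdot\nabla\omega(p)$ and $\varphi_p(z)=\Phi_p(p+z)-\Phi_p(p)$, so that $\varphi_p(0)=0$ and $\nabla\varphi_p(0)=0$. For a smooth function $\varphi$ near the origin of $\mathbb{R}^2$ with Taylor series $\sum a_{n_1,n_2}x^{n_1}y^{n_2}$, the Newton polyhedron $\mathcal N(\varphi)$ is the convex hull of the union of the quadrants $(n_1,n_2)+[0,\infty)^2$ with $a_{n_1,n_2}\ne0$; the Newton distance is $d_\varphi=\inf\{d>0:(d,d)\in\mathcal N(\varphi)\}$ (with $\inf\emptyset=+\infty$); the principal face is the face (vertex or edge) of minimal dimension of $\mathcal N(\varphi)$ containing $(d_\varphi,d_\varphi)$. A local coordinate system at the origin is a smooth diffeomorphism between neighbourhoods of the origin that fixes the origin. The height $h(\varphi)$ is the supremum of the Newton distances of $\varphi$ expressed in all local coordinate systems at the origin; a system that attains it is called adapted. The Varchenko exponent $\nu(\varphi)$ is $1$ if $h(\varphi)\ge2$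 and there is an adapted local coordinate system in which the principal face is a vertex; otherwise $\nu(\varphi)=0$. The height and the Varchenko exponent of $\Phi_p$ at $p$ are $h(\varphi_p)$ and $\nu(\varphi_p)$. The point $p$ is an $A_k$ type singularity of $\Phi_p$ if $\varphi_p$, expressed in some local coordinate system $(u,v)$ at the origin, equals $\pm u^2\pm v^{k+1}$ near the origin, for some choice of the signs. Let $\Sigma_1$ be the set of $p\in[0,2\pi]^2$ with $\det\mathrm{Hess}_p\,\omega\neq0$, and, for $k=2,3$, let $\Sigma_k$ be the set of $p\in[0,2\pi]^2$ that are $A_k$ type singularities of $\Phi_p$. Then the height of $\Phi_p$ at $p$ is constant on each of $\Sigma_1,\Sigma_2,\Sigma_3$: it equals $1$ for $p\in\Sigma_1$, $6/5$ for $p\in\Sigma_2$, and $4/3$ for $p\in\Sigma_3$. Moreover, for every $p\in[0,2\pi]^2$ the height of $\Phi_p$ at $p$ is less than $2$, and hence its Varchenko exponent is $0$. -/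

import Mathlib

open Set Filter Topology
open scoped ContDiff

namespace KingGraph

noncomputable section

/-- Partial derivative in the first variable. -/
def pd1 (f : ℝ × ℝ → ℝ) : ℝ × ℝ → ℝ := fun p => deriv (fun t => f (t, p.2)) p.1

/-- Partial derivative in the second variable. -/
def pd2 (f : ℝ × ℝ → ℝ) : ℝ × ℝ → ℝ := fun p => deriv (fun t => f (p.1, t)) p.2

/-- The gradient of `f` at `p`. -/
def grad (f : ℝ × ℝ → ℝ) (p : ℝ × ℝ) : ℝ × ℝ := (pd1 f p, pd2 f p)

/-- The Hessian matrix of `f` at `p`. -/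
def hess (f : ℝ × ℝ → ℝ) (p : ℝ × ℝ) : Matrix (Fin 2) (Fin 2) ℝ :=
  !![pd1 (pd1 f) p, pd1 (pd2 f) p; pd2 (pd1 f) p, pd2 (pd2 f) p]

/-- The germ of `f` at `p`, moved to the origin and normalized to vanish there. -/
def germAt (f : ℝ × ℝ → ℝ) (p : ℝ × ℝ) : ℝ × ℝ → ℝ := fun z => f (p + z) - f p

/-- The Taylor coefficient of `x ^ m * y ^ n` of `f` at the origin. -/
def taylorCoeff (f : ℝ × ℝ → ℝ) (m n : ℕ) : ℝ :=
  (pd1^[m] (pd2^[n] f)) (0, 0) / ((m.factorial : ℝ) * (n.factorial : ℝ))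

/-- The Taylor support of `f` at the origin. -/
def taylorSupport (f : ℝ × ℝ → ℝ) : Set (ℕ × ℕ) := {n | taylorCoeff f n.1 n.2 ≠ 0}

/-- The Newton polyhedron: the convex hull of the union of the quadrants `n + [0, ∞) ^ 2`, for `n`
in the Taylor support. -/
def newtonPolyhedron (f : ℝ × ℝ → ℝ) : Set (ℝ × ℝ) :=
  convexHull ℝ (⋃ n ∈ taylorSupport f, {p : ℝ × ℝ | (n.1 : ℝ) ≤ p.1 ∧ (n.2 : ℝ) ≤ p.2})

/-- The Newton distance `inf {d > 0 : (d, d) ∈ N(f)}`. It is extended-real-valued, so that it is `⊤`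
when the Taylor series of `f` vanishes. -/
def newtonDistance (f : ℝ × ℝ → ℝ) : EReal :=
  sInf {e : EReal | ∃ d : ℝ, 0 < d ∧ (d, d) ∈ newtonPolyhedron f ∧ e = (d : EReal)}

/-- A (proper, nonempty) face of a planar polyhedron `N`: a vertex or an edge. -/
def IsFace (N F : Set (ℝ × ℝ)) : Prop := F.Nonempty ∧ F ≠ N ∧ Convex ℝ F ∧ IsExtreme ℝ N F

/-- The principal face: the face of minimal dimension of the Newton polyhedron that contains
`(d, d)`, where `d` is the Newton distance; it is the intersection of all faces that contain this
point. -/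
def principalFace (f : ℝ × ℝ → ℝ) : Set (ℝ × ℝ) :=
  ⋂₀ {F | IsFace (newtonPolyhedron f) F ∧
    ∃ d : ℝ, (d : EReal) = newtonDistance f ∧ (d, d) ∈ F}

/-- A smooth local coordinate system `y = chart x` of the plane at the origin that preserves the
origin. -/
structure LocalCoord where
  chart : OpenPartialHomeomorph (ℝ × ℝ) (ℝ × ℝ)
  zero_mem : (0 : ℝ × ℝ) ∈ chart.source
  map_zero : chart 0 = 0
  smooth : ContDiffOn ℝ ∞ chart chart.source
  smooth_symm : ContDiffOn ℝ ∞ chart.symm chart.target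

/-- The function `f` expressed in the coordinates `y`. -/
def LocalCoord.express (y : LocalCoord) (f : ℝ × ℝ → ℝ) : ℝ × ℝ → ℝ := fun z => f (y.chart.symm z)

/-- The height of a function near the origin: the supremum of the Newton distances over all smooth
local coordinate systems at the origin. -/
def height (f : ℝ × ℝ → ℝ) : EReal := ⨆ y : LocalCoord, newtonDistance (y.express f)

/-- The coordinate system `y` is adapted to `f`. -/
def IsAdapted (f : ℝ × ℝ → ℝ) (y : LocalCoord) : Prop := height f = newtonDistance (y.express f)

open Classical in
/-- Varchenko's exponent: it is `1` if the height is at least `2` and there is an adapted coordinate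
system in which the principal face is a vertex, and `0` otherwise. -/
def varchenkoExponent (f : ℝ × ℝ → ℝ) : ℕ :=
  if (∃ y : LocalCoord, IsAdapted f y ∧ ∃ v : ℝ × ℝ, principalFace (y.express f) = {v}) ∧
    ((2 : ℝ) : EReal) ≤ height f then 1 else 0

/-- The point `p` is an `A_k` type singularity of `f` (`k ≥ 1`): in suitable smooth local
coordinates at `p`, the function `f - f p` equals `± u ^ 2 ± v ^ (k + 1)`. -/
def IsASingularity (k : ℕ) (f : ℝ × ℝ → ℝ) (p : ℝ × ℝ) : Prop :=
  ∃ (y : LocalCoord) (a b : ℝ), (a = 1 ∨ a = -1) ∧ (b = 1 ∨ b = -1) ∧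
    ∀ᶠ z in 𝓝 (0 : ℝ × ℝ), y.express (germAt f p) z = a * z.1 ^ 2 + b * z.2 ^ (k + 1)

/-- The dispersion relation of the King graph. -/
def omega (z : ℝ × ℝ) : ℝ :=
  8 - 2 * Real.cos z.1 - 2 * Real.cos z.2 - 2 * Real.cos (z.1 + z.2) - 2 * Real.cos (z.1 - z.2)

/-- The phase `ω(x, y) - (x, y) · ∇ω(x₀, y₀)`, where `p = (x₀, y₀)`. -/
def phase (p : ℝ × ℝ) : ℝ × ℝ → ℝ :=
  fun z => omega z - (z.1 * (grad omega p).1 + z.2 * (grad omega p).2)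

/-- The square `[0, 2π]²`. -/
def square : Set (ℝ × ℝ) := Icc 0 (2 * Real.pi) ×ˢ Icc 0 (2 * Real.pi)

/-- The nondegenerate points. -/
def Sigma1 : Set (ℝ × ℝ) := {p | p ∈ square ∧ (hess omega p).det ≠ 0}

/-- The points that are `A_2` type singularities of their phase. -/
def Sigma2 : Set (ℝ × ℝ) := {p | p ∈ square ∧ IsASingularity 2 (phase p) p}

/-- The points that are `A_3` type singularities of their phase. -/
def Sigma3 : Set (ℝ × ℝ) := {p | p ∈ square ∧ IsASingularity 3 (phase p) p}

/-- The height of `f` at the point `p`. -/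
def heightAt (f : ℝ × ℝ → ℝ) (p : ℝ × ℝ) : EReal := height (germAt f p)

/-- Varchenko's exponent of `f` at the point `p`. -/
def varchenkoExponentAt (f : ℝ × ℝ → ℝ) (p : ℝ × ℝ) : ℕ := varchenkoExponent (germAt f p)

end

end KingGraph

open Asymptotics

namespace KingGraph

/-! ### Orders of vanishing of smooth functions of one variable -/

/-! The Newton distance of `x ^ 2 + y ^ (k + 1)` is `2 (k + 1) / (k + 3)`. The upper bounds on
heights come from one coordinate-free obstruction to exceeding this value. If a germ does so in some
coordinates, its Taylor support there misses enough exponents that either the quadratic part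
vanishes, or along one axis the germ is `O(t ^ (k + 2))` and its differential is `O(t ^ ((k + 1) / 2
+ 1))`, with rounded-down division. Pulled back by the chart, the axis becomes a regular curve with
the same estimates for the original germ (`exists_curve_of_lt_newtonDistance`). So no normalization
to adapted coordinates is needed: it suffices to exclude such curves.

For `± u ^ 2 ± v ^ (k + 1)` the differential forces `u` to be small on the curve, then the value
forces `v` to be small, and the curve has zero velocity. The matching lower bound is read off in the
normalizing coordinates. This settles `A_2` and `A_3`.

For the phase, only the differential is used. Its Hessian never vanishes (`not_fderiv_isLittleO`),
so the curve alternative remains. With `k = 1` the velocity lies in the kernel of the Hessian, which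
is trivial at nondegenerate points. With `k = 5` the gradient map would be stationary to third order
along a regular curve, which trigonometric algebra rules out everywhere (`velocity_eq_zero`). Hence
every height is at most `3 / 2`, and the Varchenko exponent vanishes. -/

theorem contDiffAt_deriv {f : ℝ → ℝ} {x : ℝ} (hf : ContDiffAt ℝ ∞ f x) :
    ContDiffAt ℝ ∞ (deriv f) x := by
  have h : ContDiffAt ℝ ∞ (fun t => fderiv ℝ f t 1) x :=
    (hf.fderiv_right (m := ∞) (by simp)).clm_apply contDiffAt_const
  exact h

theorem eventually_differentiableAt {E : Type*} [NormedAddCommGroup E] [NormedSpace ℝ E]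
    {F : Type*} [NormedAddCommGroup F] [NormedSpace ℝ F] {f : E → F} {x : E}
    (hf : ContDiffAt ℝ ∞ f x) : ∀ᶠ z in 𝓝 x, DifferentiableAt ℝ f z := by
  have h1 : ContDiffAt ℝ 1 f x := hf.of_le (by exact_mod_cast le_top)
  filter_upwards [h1.eventually (by simp)] with z hz
  exact hz.differentiableAt (by simp)

/-- Mean value inequality on the ball of radius `|t|`: integrating gains one power of `t`. -/
theorem isBigO_pow_succ_of_deriv {f : ℝ → ℝ} {n : ℕ}
    (hf : ∀ᶠ t in 𝓝 (0 : ℝ), DifferentiableAt ℝ f t) (h0 : f 0 = 0)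
    (hd : deriv f =O[𝓝 0] fun t : ℝ => t ^ n) : f =O[𝓝 0] fun t : ℝ => t ^ (n + 1) := by
  obtain ⟨C, hC⟩ := hd.bound
  obtain ⟨ε, hε, hb⟩ := Metric.eventually_nhds_iff_ball.1 (hf.and hC)
  refine IsBigO.of_bound C ?_
  filter_upwards [Metric.ball_mem_nhds (0 : ℝ) hε] with t ht
  have hsub : Metric.closedBall (0 : ℝ) |t| ⊆ Metric.ball 0 ε := by
    apply Metric.closedBall_subset_ball
    simpa using ht
  have hC0 : ∀ x ∈ Metric.closedBall (0 : ℝ) |t|, ‖deriv f x‖ ≤ |C| * |t| ^ n := by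
    intro x hx
    refine (hb x (hsub hx)).2.trans ?_
    rw [norm_pow]
    have hx' : ‖x‖ ≤ |t| := by simpa using hx
    calc C * ‖x‖ ^ n ≤ |C| * ‖x‖ ^ n := by gcongr; exact le_abs_self C
      _ ≤ |C| * |t| ^ n := by gcongr
  -- `IsBigO.bound` gives no sign for `C`. If it is negative, the bound makes the derivative, and
  -- hence `f`, vanish near `0`.
  by_cases hCs : 0 ≤ C
  · have := (convex_closedBall (0 : ℝ) |t|).norm_image_sub_le_of_norm_deriv_le
      (fun x hx => (hb x (hsub hx)).1) hC0 (x := 0) (y := t) (by simp) (by simp)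
    rw [h0, sub_zero, sub_zero, abs_of_nonneg hCs] at this
    rw [norm_pow, pow_succ, ← mul_assoc]
    simpa using this
  · have hz : ∀ x ∈ Metric.closedBall (0 : ℝ) |t|, ‖deriv f x‖ ≤ 0 := by
      intro x hx
      refine (hb x (hsub hx)).2.trans ?_
      exact mul_nonpos_of_nonpos_of_nonneg (le_of_not_ge hCs) (norm_nonneg _)
    have h1 := (convex_closedBall (0 : ℝ) |t|).norm_image_sub_le_of_norm_deriv_le
      (fun x hx => (hb x (hsub hx)).1) hz (x := 0) (y := t) (by simp) (by simp)
    have h2 : f t = 0 := by simpa [h0] using h1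
    have h3 : 0 ≤ C * ‖t‖ ^ n := by
      have := (hb t (hsub (by simp))).2
      rw [norm_pow] at this
      exact (norm_nonneg _).trans this
    rw [h2, norm_pow, pow_succ, ← mul_assoc, norm_zero]
    exact mul_nonneg h3 (norm_nonneg _)

/-- Taylor's formula cut after its first possibly nonzero term, by induction through the derivative.
It makes vanishing of derivatives at `0` equivalent to a growth estimate, and growth estimates pass
easily through coordinate changes. -/
theorem isBigO_sub_leading_term {n : ℕ} {f : ℝ → ℝ} (hf : ContDiffAt ℝ ∞ f 0)
    (h : ∀ j < n, deriv^[j] f 0 = 0) :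
    (fun t => f t - deriv^[n] f 0 / n.factorial * t ^ n) =O[𝓝 0] fun t : ℝ => t ^ (n + 1) := by
  induction n generalizing f with
  | zero =>
    have := (hf.differentiableAt (by simp)).isBigO_sub
    simpa using this
  | succ n ih =>
    have hd := ih (contDiffAt_deriv hf) (fun j hj => h (j + 1) (by omega))
    have hev := eventually_differentiableAt hf
    refine isBigO_pow_succ_of_deriv ?_ ?_ ?_
    · filter_upwards [hev] with t ht
      fun_prop
    · have := h 0 (by omega)
      simp only [Function.iterate_zero, id] at this
      simp [this]
    · refine hd.congr' ?_ EventuallyEq.rfl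
      filter_upwards [hev] with t ht
      rw [deriv_fun_sub ht (by fun_prop), deriv_const_mul _ (by fun_prop), deriv_pow_field]
      rw [Function.iterate_succ_apply, Nat.factorial_succ]
      push_cast
      have : (n.factorial : ℝ) ≠ 0 := by positivity
      field_simp

theorem isBigO_pow_of_iterate_deriv_eq_zero {n : ℕ} {f : ℝ → ℝ} (hf : ContDiffAt ℝ ∞ f 0)
    (h : ∀ j < n, deriv^[j] f 0 = 0) : f =O[𝓝 0] fun t : ℝ => t ^ n := by
  have h1 := isBigO_sub_leading_term hf h
  have h2 : (fun t : ℝ => t ^ (n + 1)) =O[𝓝 0] fun t : ℝ => t ^ n :=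
    IsBigO.of_bound 1 (by
      filter_upwards [Metric.ball_mem_nhds (0 : ℝ) one_pos] with t ht
      have ht' : |t| ≤ 1 := by simpa using (mem_ball_zero_iff.1 ht).le
      rw [pow_succ, norm_mul, one_mul]
      exact mul_le_of_le_one_right (norm_nonneg _) ht')
  have h3 := (h1.trans h2).add (isBigO_const_mul_self (deriv^[n] f 0 / n.factorial)
    (fun t : ℝ => t ^ n) (𝓝 0))
  simpa using h3

theorem eq_zero_of_mul_pow_isBigO {c : ℝ} {n : ℕ}
    (h : (fun t : ℝ => c * t ^ n) =O[𝓝 0] fun t : ℝ => t ^ (n + 1)) : c = 0 := by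
  by_contra hc
  obtain ⟨C, hC⟩ := h.bound
  have h1 : ∀ᶠ t in 𝓝[≠] (0 : ℝ), |c| ≤ C * |t| := by
    filter_upwards [hC.filter_mono nhdsWithin_le_nhds, self_mem_nhdsWithin] with t ht h0
    have hp : 0 < |t| ^ n := pow_pos (abs_pos.2 h0) n
    rw [norm_mul, norm_pow, norm_pow, pow_succ] at ht
    simp only [Real.norm_eq_abs] at ht
    nlinarith
  have h2 : Tendsto (fun t : ℝ => C * |t|) (𝓝[≠] 0) (𝓝 0) := by
    have : Continuous fun t : ℝ => C * |t| := by fun_prop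
    simpa using (this.tendsto 0).mono_left nhdsWithin_le_nhds
  have := ge_of_tendsto h2 h1
  exact hc (abs_nonpos_iff.1 this)

theorem iterate_deriv_eq_zero_of_isBigO {n : ℕ} {f : ℝ → ℝ} (hf : ContDiffAt ℝ ∞ f 0)
    (h : f =O[𝓝 0] fun t : ℝ => t ^ n) : ∀ j < n, deriv^[j] f 0 = 0 := by
  intro j
  induction j using Nat.strong_induction_on with
  | _ j ih =>
    intro hj
    have h1 := isBigO_sub_leading_term hf (fun i hi => ih i hi (hi.trans hj))
    have h2 : f =O[𝓝 0] fun t : ℝ => t ^ (j + 1) := by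
      refine h.trans (IsBigO.of_bound 1 ?_)
      filter_upwards [Metric.ball_mem_nhds (0 : ℝ) one_pos] with t ht
      have ht' : |t| ≤ 1 := by simpa using (mem_ball_zero_iff.1 ht).le
      rw [norm_pow, norm_pow, one_mul]
      exact pow_le_pow_of_le_one (norm_nonneg _) ht' hj
    have h3 := eq_zero_of_mul_pow_isBigO (by simpa using h2.sub h1)
    have : (j.factorial : ℝ) ≠ 0 := by positivity
    simpa [this] using h3

/-! ### Partial derivatives of germs of smooth functions of two variables -/

theorem hasDerivAt_fst {f : ℝ × ℝ → ℝ} {z : ℝ × ℝ} (hf : DifferentiableAt ℝ f z) :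
    HasDerivAt (fun t => f (t, z.2)) (fderiv ℝ f z (1, 0)) z.1 := by
  have h : HasDerivAt (fun t : ℝ => (t, z.2)) ((1 : ℝ), (0 : ℝ)) z.1 :=
    (hasDerivAt_id _).prodMk (hasDerivAt_const _ _)
  exact HasFDerivAt.comp_hasDerivAt (f := fun t : ℝ => (t, z.2)) z.1 hf.hasFDerivAt h

theorem hasDerivAt_snd {f : ℝ × ℝ → ℝ} {z : ℝ × ℝ} (hf : DifferentiableAt ℝ f z) :
    HasDerivAt (fun t => f (z.1, t)) (fderiv ℝ f z (0, 1)) z.2 := by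
  have h : HasDerivAt (fun t : ℝ => (z.1, t)) ((0 : ℝ), (1 : ℝ)) z.2 :=
    (hasDerivAt_const _ _).prodMk (hasDerivAt_id _)
  exact HasFDerivAt.comp_hasDerivAt (f := fun t : ℝ => (z.1, t)) z.2 hf.hasFDerivAt h

theorem pd1_eq_fderiv {f : ℝ × ℝ → ℝ} {z : ℝ × ℝ} (hf : DifferentiableAt ℝ f z) :
    pd1 f z = fderiv ℝ f z (1, 0) := (hasDerivAt_fst hf).deriv

theorem pd2_eq_fderiv {f : ℝ × ℝ → ℝ} {z : ℝ × ℝ} (hf : DifferentiableAt ℝ f z) :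
    pd2 f z = fderiv ℝ f z (0, 1) := (hasDerivAt_snd hf).deriv

theorem fderiv_eq_pd {f : ℝ × ℝ → ℝ} {z : ℝ × ℝ} (hf : DifferentiableAt ℝ f z) :
    fderiv ℝ f z = pd1 f z • ContinuousLinearMap.fst ℝ ℝ ℝ +
      pd2 f z • ContinuousLinearMap.snd ℝ ℝ ℝ := by
  ext <;> simp [pd1_eq_fderiv hf, pd2_eq_fderiv hf]

theorem pd1_eventuallyEq_fderiv {f : ℝ × ℝ → ℝ} {z : ℝ × ℝ} (hf : ContDiffAt ℝ ∞ f z) :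
    pd1 f =ᶠ[𝓝 z] fun w => fderiv ℝ f w (1, 0) := by
  filter_upwards [eventually_differentiableAt hf] with w hw using pd1_eq_fderiv hw

theorem pd2_eventuallyEq_fderiv {f : ℝ × ℝ → ℝ} {z : ℝ × ℝ} (hf : ContDiffAt ℝ ∞ f z) :
    pd2 f =ᶠ[𝓝 z] fun w => fderiv ℝ f w (0, 1) := by
  filter_upwards [eventually_differentiableAt hf] with w hw using pd2_eq_fderiv hw

theorem contDiffAt_pd1 {f : ℝ × ℝ → ℝ} {z : ℝ × ℝ} (hf : ContDiffAt ℝ ∞ f z) :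
    ContDiffAt ℝ ∞ (pd1 f) z :=
  ((hf.fderiv_right (m := ∞) (by simp)).clm_apply contDiffAt_const).congr_of_eventuallyEq
    (pd1_eventuallyEq_fderiv hf)

theorem contDiffAt_pd2 {f : ℝ × ℝ → ℝ} {z : ℝ × ℝ} (hf : ContDiffAt ℝ ∞ f z) :
    ContDiffAt ℝ ∞ (pd2 f) z :=
  ((hf.fderiv_right (m := ∞) (by simp)).clm_apply contDiffAt_const).congr_of_eventuallyEq
    (pd2_eventuallyEq_fderiv hf)

theorem pd1_congr {f g : ℝ × ℝ → ℝ} {z : ℝ × ℝ} (h : f =ᶠ[𝓝 z] g) :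
    pd1 f =ᶠ[𝓝 z] pd1 g := by
  filter_upwards [h.eventuallyEq_nhds] with w hw
  have hc : Tendsto (fun t : ℝ => (t, w.2)) (𝓝 w.1) (𝓝 w) :=
    (Continuous.tendsto (by fun_prop) w.1)
  exact (hw.comp_tendsto hc).deriv_eq

theorem pd2_congr {f g : ℝ × ℝ → ℝ} {z : ℝ × ℝ} (h : f =ᶠ[𝓝 z] g) :
    pd2 f =ᶠ[𝓝 z] pd2 g := by
  filter_upwards [h.eventuallyEq_nhds] with w hw
  have hc : Tendsto (fun t : ℝ => (w.1, t)) (𝓝 w.2) (𝓝 w) :=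
    (Continuous.tendsto (by fun_prop) w.2)
  exact (hw.comp_tendsto hc).deriv_eq

theorem iterate_congr {D : (ℝ × ℝ → ℝ) → ℝ × ℝ → ℝ} {z : ℝ × ℝ}
    (hD : ∀ f g : ℝ × ℝ → ℝ, f =ᶠ[𝓝 z] g → D f =ᶠ[𝓝 z] D g) {f g : ℝ × ℝ → ℝ}
    (h : f =ᶠ[𝓝 z] g) (n : ℕ) : D^[n] f =ᶠ[𝓝 z] D^[n] g := by
  induction n generalizing f g with
  | zero => exact h
  | succ n ih => exact ih (hD _ _ h)

theorem pd1_pd2_comm {f : ℝ × ℝ → ℝ} {z : ℝ × ℝ} (hf : ContDiffAt ℝ ∞ f z) :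
    pd1 (pd2 f) =ᶠ[𝓝 z] pd2 (pd1 f) := by
  have h2 : ContDiffAt ℝ 2 f z :=
    by exact_mod_cast contDiffAt_infty.1 hf 2
  filter_upwards [h2.eventually (by simp), (pd1_eventuallyEq_fderiv hf).eventuallyEq_nhds,
    (pd2_eventuallyEq_fderiv hf).eventuallyEq_nhds] with w hw h1 h2
  have hd : DifferentiableAt ℝ (fderiv ℝ f) w :=
    (hw.fderiv_right (m := 1) (by norm_num)).differentiableAt (by simp)
  have hs := hw.isSymmSndFDerivAt (by simp)
  rw [(pd1_congr h2).eq_of_nhds, (pd2_congr h1).eq_of_nhds,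
    pd1_eq_fderiv (hd.clm_apply (differentiableAt_const _)),
    pd2_eq_fderiv (hd.clm_apply (differentiableAt_const _)),
    fderiv_clm_apply hd (differentiableAt_const _),
    fderiv_clm_apply hd (differentiableAt_const _)]
  simpa using hs (1, 0) (0, 1)

/-- `taylorCoeff` applies `pd2` before `pd1`; commuting them lets coefficients of type `(1, n)` be
read as derivatives of `pd1 f` along the second axis. -/
theorem pd1_iterate_pd2_comm (n : ℕ) {f : ℝ × ℝ → ℝ} {z : ℝ × ℝ} (hf : ContDiffAt ℝ ∞ f z) :
    pd1 (pd2^[n] f) =ᶠ[𝓝 z] pd2^[n] (pd1 f) := by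
  induction n generalizing f with
  | zero => exact EventuallyEq.rfl
  | succ n ih =>
    exact (ih (contDiffAt_pd2 hf)).trans
      (iterate_congr (fun _ _ => pd2_congr) (pd1_pd2_comm hf) n)

theorem iterate_deriv_fst (f : ℝ × ℝ → ℝ) (c : ℝ) (n : ℕ) :
    deriv^[n] (fun t => f (t, c)) = fun t => pd1^[n] f (t, c) := by
  induction n generalizing f with
  | zero => rfl
  | succ n ih => exact ih (pd1 f)

theorem iterate_deriv_snd (f : ℝ × ℝ → ℝ) (c : ℝ) (n : ℕ) :
    deriv^[n] (fun t => f (c, t)) = fun t => pd2^[n] f (c, t) := by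
  induction n generalizing f with
  | zero => rfl
  | succ n ih => exact ih (pd2 f)

theorem taylorCoeff_congr {f g : ℝ × ℝ → ℝ} (h : f =ᶠ[𝓝 0] g) (m n : ℕ) :
    taylorCoeff f m n = taylorCoeff g m n := by
  have := (iterate_congr (fun _ _ => pd1_congr)
    (iterate_congr (fun _ _ => pd2_congr) h n) m).eq_of_nhds
  unfold taylorCoeff
  rw [show ((0, 0) : ℝ × ℝ) = 0 from rfl, this]

theorem newtonDistance_congr {f g : ℝ × ℝ → ℝ} (h : f =ᶠ[𝓝 0] g) :
    newtonDistance f = newtonDistance g := by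
  have : taylorSupport f = taylorSupport g := by
    ext n
    simp only [taylorSupport, mem_ofPred_eq, taylorCoeff_congr h]
  unfold newtonDistance newtonPolyhedron
  rw [this]

end KingGraph

namespace KingGraph

open Asymptotics

/-! ### Newton distances -/

theorem newtonDistance_le {f : ℝ × ℝ → ℝ} {d : ℝ} (hd : 0 < d) (h : (d, d) ∈ newtonPolyhedron f) :
    newtonDistance f ≤ d := sInf_le ⟨d, hd, h, rfl⟩

theorem mem_newtonPolyhedron {f : ℝ × ℝ → ℝ} {m n : ℕ} (h : taylorCoeff f m n ≠ 0) {p : ℝ × ℝ}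
    (h1 : (m : ℝ) ≤ p.1) (h2 : (n : ℝ) ≤ p.2) : p ∈ newtonPolyhedron f :=
  subset_convexHull ℝ _ (mem_biUnion (x := (m, n)) h ⟨h1, h2⟩)

/-- If a convex combination of two exponents of the Taylor support lies below `(d, d)`, then the
Newton distance is at most `d`. -/
theorem newtonDistance_le_of_combination {f : ℝ × ℝ → ℝ} {m n m' n' : ℕ} {d l : ℝ} (hd : 0 < d)
    (h : taylorCoeff f m n ≠ 0) (h' : taylorCoeff f m' n' ≠ 0) (hl0 : 0 ≤ l) (hl1 : l ≤ 1)
    (h1 : l * m + (1 - l) * m' ≤ d) (h2 : l * n + (1 - l) * n' ≤ d) : newtonDistance f ≤ d := by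
  refine newtonDistance_le hd ?_
  -- Both exponents are translated by the slack `(r1, r2)`, which is nonnegative, so that the convex
  -- combination is exactly `(d, d)`.
  set r1 := d - (l * m + (1 - l) * m') with hr1
  set r2 := d - (l * n + (1 - l) * n') with hr2
  have hP : ((m : ℝ) + r1, (n : ℝ) + r2) ∈ newtonPolyhedron f :=
    mem_newtonPolyhedron h (by simp only; linarith) (by simp only; linarith)
  have hQ : ((m' : ℝ) + r1, (n' : ℝ) + r2) ∈ newtonPolyhedron f :=
    mem_newtonPolyhedron h' (by simp only; linarith) (by simp only; linarith)
  have := convex_convexHull ℝ _ hP hQ hl0 (sub_nonneg.2 hl1) (by ring)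
  rw [Prod.smul_mk, Prod.smul_mk, Prod.mk_add_mk] at this
  simp only [smul_eq_mul] at this
  rwa [show l * (m + r1) + (1 - l) * (m' + r1) = d by rw [hr1]; ring,
    show l * (n + r2) + (1 - l) * (n' + r2) = d by rw [hr2]; ring] at this

theorem newtonDistance_le_of_taylorCoeff {f : ℝ × ℝ → ℝ} {m n : ℕ} {d : ℝ} (hd : 0 < d)
    (h : taylorCoeff f m n ≠ 0) (h1 : (m : ℝ) ≤ d) (h2 : (n : ℝ) ≤ d) : newtonDistance f ≤ d :=
  newtonDistance_le hd (mem_newtonPolyhedron h h1 h2)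

/-- The Newton distance of a germ whose Taylor support lies in the half-plane
`α m + β n ≥ 1` is at least `1 / (α + β)`. -/
theorem le_newtonDistance {f : ℝ × ℝ → ℝ} {α β : ℝ} (hα : 0 < α) (hβ : 0 < β)
    (h : ∀ m n : ℕ, taylorCoeff f m n ≠ 0 → 1 ≤ α * m + β * n) :
    ((1 / (α + β) : ℝ) : EReal) ≤ newtonDistance f := by
  refine le_sInf ?_
  rintro _ ⟨d, -, hN, rfl⟩
  have hsub : newtonPolyhedron f ⊆ {p : ℝ × ℝ | 1 ≤ α * p.1 + β * p.2} := by
    refine convexHull_min ?_ ?_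
    · refine iUnion₂_subset ?_
      rintro ⟨m, n⟩ hmn ⟨x, y⟩ ⟨hx, hy⟩
      have h1 := h m n hmn
      simp only at hx hy
      have h2 := mul_le_mul_of_nonneg_left hx hα.le
      have h3 := mul_le_mul_of_nonneg_left hy hβ.le
      change 1 ≤ α * x + β * y
      linarith
    · rintro ⟨x, y⟩ hx ⟨x', y'⟩ hx' a b ha hb hab
      change 1 ≤ α * x + β * y at hx
      change 1 ≤ α * x' + β * y' at hx'
      change 1 ≤ α * (a * x + b * x') + β * (a * y + b * y')
      nlinarith [mul_le_mul_of_nonneg_left hx ha, mul_le_mul_of_nonneg_left hx' hb]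
  have h1 : 1 ≤ α * d + β * d := hsub hN
  rw [EReal.coe_le_coe_iff, div_le_iff₀ (by positivity)]
  linarith

/-- The Taylor coefficients that vanish when the Newton distance is greater than that of
`x ^ 2 + y ^ (k + 1)`. -/
theorem taylorCoeff_eq_zero_of_lt_newtonDistance {f : ℝ × ℝ → ℝ} {k : ℕ} (hk : 1 ≤ k)
    (h : ((2 * (k + 1) / (k + 3) : ℝ) : EReal) < newtonDistance f) :
    taylorCoeff f 1 0 = 0 ∧ taylorCoeff f 0 1 = 0 ∧ taylorCoeff f 1 1 = 0 ∧
    ((taylorCoeff f 2 0 = 0 ∧ taylorCoeff f 0 2 = 0) ∨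
      (∀ j < k + 2, taylorCoeff f 0 j = 0) ∧ (∀ j < (k + 1) / 2 + 1, taylorCoeff f 1 j = 0) ∨
      (∀ j < k + 2, taylorCoeff f j 0 = 0) ∧ (∀ j < (k + 1) / 2 + 1, taylorCoeff f j 1 = 0)) := by
  have hk' : (1 : ℝ) ≤ k := by exact_mod_cast hk
  have hD : (1 : ℝ) ≤ 2 * (k + 1) / (k + 3) := by
    rw [le_div_iff₀ (by positivity)]
    linarith
  have hD0 : (0 : ℝ) < 2 * (k + 1) / (k + 3) := by linarith
  -- The threshold is at least `1`, so an exponent in the unit box would already push the Newton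
  -- distance down to it.
  have small : ∀ m n : ℕ, m ≤ 1 → n ≤ 1 → taylorCoeff f m n = 0 := by
    intro m n hm hn
    by_contra hc
    refine h.not_ge (newtonDistance_le_of_taylorCoeff hD0 hc ?_ ?_)
    · exact le_trans (by exact_mod_cast hm) hD
    · exact le_trans (by exact_mod_cast hn) hD
  refine ⟨small 1 0 (by norm_num) (by norm_num), small 0 1 (by norm_num) (by norm_num),
    small 1 1 (by norm_num) (by norm_num), ?_⟩
  -- The weight `(k + 1) / (k + 3)` on `(2, 0)` against `(0, j)`, and `(k - 1) / (k + 3)` against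
  -- `(1, j)`, make the first coordinate of the combination equal to the threshold. The second
  -- coordinate stays below it when `j ≤ k + 1`, respectively `2 j ≤ k + 1`. The case of `(0, 2)` is
  -- symmetric.
  have hl1 : ((k + 1) / (k + 3) : ℝ) ≤ 1 := by
    rw [div_le_one (by positivity)]
    linarith
  have hm1 : ((k - 1) / (k + 3) : ℝ) ≤ 1 := by
    rw [div_le_one (by positivity)]
    linarith
  have hm0 : (0 : ℝ) ≤ (k - 1) / (k + 3) := div_nonneg (by linarith) (by positivity)
  have e1 : ((k + 1) / (k + 3) : ℝ) * 2 = 2 * (k + 1) / (k + 3) := by ring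
  have b1 : ∀ j : ℕ, j < k + 2 →
      (1 - (k + 1) / (k + 3) : ℝ) * j ≤ 2 * (k + 1) / (k + 3) := by
    intro j hj
    have hj' : (j : ℝ) ≤ k + 1 := by exact_mod_cast Nat.lt_succ_iff.1 hj
    rw [show (1 - (k + 1) / (k + 3) : ℝ) * j = 2 * j / (k + 3) by field_simp; ring]
    gcongr
  have b2 : ∀ j : ℕ, j < (k + 1) / 2 + 1 →
      (1 - (k - 1) / (k + 3) : ℝ) * j ≤ 2 * (k + 1) / (k + 3) := by
    intro j hj
    have hj' : 2 * (j : ℝ) ≤ k + 1 := by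
      have : 2 * j ≤ k + 1 := by omega
      exact_mod_cast this
    rw [show (1 - (k - 1) / (k + 3) : ℝ) * j = 2 * (2 * j) / (k + 3) by field_simp; ring]
    gcongr
  have e2 : ((k - 1) / (k + 3) : ℝ) * 2 + (1 - (k - 1) / (k + 3)) = 2 * (k + 1) / (k + 3) := by
    field_simp
    ring
  by_cases h20 : taylorCoeff f 2 0 = 0
  · by_cases h02 : taylorCoeff f 0 2 = 0
    · exact Or.inl ⟨h20, h02⟩
    · refine Or.inr (Or.inr ⟨fun j hj => ?_, fun j hj => ?_⟩)
      · by_contra hc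
        refine h.not_ge (newtonDistance_le_of_combination (l := (k + 1) / (k + 3)) hD0 h02 hc
          (by positivity) hl1 ?_ ?_)
        · simpa using b1 j hj
        · simpa using e1.le
      · by_contra hc
        refine h.not_ge (newtonDistance_le_of_combination (l := (k - 1) / (k + 3)) hD0 h02 hc
          hm0 hm1 ?_ ?_)
        · simpa using b2 j hj
        · simpa using e2.le
  · refine Or.inr (Or.inl ⟨fun j hj => ?_, fun j hj => ?_⟩)
    · by_contra hc
      refine h.not_ge (newtonDistance_le_of_combination (l := (k + 1) / (k + 3)) hD0 h20 hc
        (by positivity) hl1 ?_ ?_)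
      · simpa using e1.le
      · simpa using b1 j hj
    · by_contra hc
      refine h.not_ge (newtonDistance_le_of_combination (l := (k - 1) / (k + 3)) hD0 h20 hc
        hm0 hm1 ?_ ?_)
      · simpa using e2.le
      · simpa using b2 j hj

/-! ### Vanishing along an axis -/

theorem iterate_pd_eq_zero {f : ℝ × ℝ → ℝ} {m n : ℕ} (h : taylorCoeff f m n = 0) :
    pd1^[m] (pd2^[n] f) (0, 0) = 0 := by
  have h1 : ((m.factorial : ℝ) * (n.factorial : ℝ)) ≠ 0 := by positivity
  simpa [taylorCoeff, h1] using h

theorem contDiffAt_fst_line {f : ℝ × ℝ → ℝ} (hf : ContDiffAt ℝ ∞ f 0) :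
    ContDiffAt ℝ ∞ (fun t : ℝ => f (t, 0)) 0 :=
  ContDiffAt.comp (f := fun t : ℝ => (t, (0 : ℝ))) 0 hf (by fun_prop)

theorem contDiffAt_snd_line {f : ℝ × ℝ → ℝ} (hf : ContDiffAt ℝ ∞ f 0) :
    ContDiffAt ℝ ∞ (fun t : ℝ => f (0, t)) 0 :=
  ContDiffAt.comp (f := fun t : ℝ => ((0 : ℝ), t)) 0 hf (by fun_prop)

theorem pow_isBigO_pow {m n : ℕ} (h : m ≤ n) :
    (fun t : ℝ => t ^ n) =O[𝓝 0] fun t : ℝ => t ^ m := by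
  refine IsBigO.of_bound 1 ?_
  filter_upwards [Metric.ball_mem_nhds (0 : ℝ) one_pos] with t ht
  have ht' : |t| ≤ 1 := by simpa using (mem_ball_zero_iff.1 ht).le
  rw [norm_pow, norm_pow, one_mul]
  exact pow_le_pow_of_le_one (norm_nonneg _) ht' h

theorem isBigO_fderiv_of_pd {f : ℝ × ℝ → ℝ} {g : ℝ → ℝ × ℝ} {e : ℝ → ℝ}
    (hf : ∀ᶠ t in 𝓝 0, DifferentiableAt ℝ f (g t))
    (h1 : (fun t => pd1 f (g t)) =O[𝓝 0] e) (h2 : (fun t => pd2 f (g t)) =O[𝓝 0] e) :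
    (fun t => fderiv ℝ f (g t)) =O[𝓝 0] e := by
  have h3 : (fun t => ‖pd1 f (g t)‖ * ‖ContinuousLinearMap.fst ℝ ℝ ℝ‖ +
      ‖pd2 f (g t)‖ * ‖ContinuousLinearMap.snd ℝ ℝ ℝ‖) =O[𝓝 0] e :=
    ((h1.norm_left.mul (isBigO_refl (fun _ => ‖ContinuousLinearMap.fst ℝ ℝ ℝ‖) _)).trans
      (by simpa [mul_comm] using isBigO_const_mul_self ‖ContinuousLinearMap.fst ℝ ℝ ℝ‖ e (𝓝 0))).add
    ((h2.norm_left.mul (isBigO_refl (fun _ => ‖ContinuousLinearMap.snd ℝ ℝ ℝ‖) _)).trans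
      (by simpa [mul_comm] using isBigO_const_mul_self ‖ContinuousLinearMap.snd ℝ ℝ ℝ‖ e (𝓝 0)))
  refine IsBigO.trans (IsBigO.of_bound 1 ?_) h3
  filter_upwards [hf] with t ht
  rw [fderiv_eq_pd ht, one_mul]
  refine (norm_add_le _ _).trans ?_
  rw [norm_smul, norm_smul]
  exact le_abs_self _

/-- A germ whose Newton distance is greater than that of `x ^ 2 + y ^ (k + 1)` either has no
quadratic part, or vanishes together with its differential to high order along an axis. -/
theorem vanishing_of_lt_newtonDistance {f : ℝ × ℝ → ℝ} (hf : ContDiffAt ℝ ∞ f 0) {k : ℕ}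
    (hk : 1 ≤ k) (h : ((2 * (k + 1) / (k + 3) : ℝ) : EReal) < newtonDistance f) :
    (fun w => fderiv ℝ f w) =o[𝓝 0] (fun w => w) ∨
    ∃ v : ℝ × ℝ, v ≠ 0 ∧ (fun t : ℝ => f (t • v)) =O[𝓝 0] (fun t : ℝ => t ^ (k + 2)) ∧
      (fun t : ℝ => fderiv ℝ f (t • v)) =O[𝓝 0] (fun t : ℝ => t ^ ((k + 1) / 2 + 1)) := by
  obtain ⟨h10, h01, h11, h'⟩ := taylorCoeff_eq_zero_of_lt_newtonDistance hk h
  have hm : (k + 1) / 2 + 1 ≤ k + 1 := by omega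
  have hdiff : ∀ v : ℝ × ℝ, ∀ᶠ t in 𝓝 (0 : ℝ), DifferentiableAt ℝ f (t • v) := by
    intro v
    have : Tendsto (fun t : ℝ => t • v) (𝓝 0) (𝓝 0) := by
      have := (show Continuous fun t : ℝ => t • v by fun_prop).tendsto 0
      simpa using this
    exact this.eventually (eventually_differentiableAt hf)
  have comm : ∀ j, pd1 (pd2^[j] f) (0, 0) = pd2^[j] (pd1 f) (0, 0) := fun j =>
    (pd1_iterate_pd2_comm j hf).eq_of_nhds
  rcases h' with ⟨h20, h02⟩ | ⟨h0, h1⟩ | ⟨h0, h1⟩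
  · left
    -- Applied to the two partial derivatives of `f`, whose values and first derivatives at the
    -- origin all vanish.
    have key : ∀ g : ℝ × ℝ → ℝ, ContDiffAt ℝ ∞ g 0 → g 0 = 0 → pd1 g 0 = 0 → pd2 g 0 = 0 →
        g =o[𝓝 0] (fun w : ℝ × ℝ => w) := by
      intro g hg h0 h1 h2
      have hd := hg.differentiableAt (by simp)
      have := hd.hasFDerivAt.isLittleO
      rw [fderiv_eq_pd hd, h1, h2] at this
      simpa [h0] using this
    have o1 := key _ (contDiffAt_pd1 hf) (iterate_pd_eq_zero h10) (iterate_pd_eq_zero h20)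
      ((comm 1).symm.trans (iterate_pd_eq_zero h11))
    have o2 := key _ (contDiffAt_pd2 hf) (iterate_pd_eq_zero h01) (iterate_pd_eq_zero h11)
      (iterate_pd_eq_zero h02)
    have e : (fun w => fderiv ℝ f w) =ᶠ[𝓝 0] fun w =>
        pd1 f w • ContinuousLinearMap.fst ℝ ℝ ℝ + pd2 f w • ContinuousLinearMap.snd ℝ ℝ ℝ := by
      filter_upwards [eventually_differentiableAt hf] with w hw using fderiv_eq_pd hw
    refine IsLittleO.congr' (IsLittleO.add ?_ ?_) e.symm EventuallyEq.rfl
    · have := o1.norm_right.smul_isBigO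
        (isBigO_refl (fun _ => ContinuousLinearMap.fst ℝ ℝ ℝ) (𝓝 (0 : ℝ × ℝ)))
      refine this.trans_isBigO (IsBigO.of_bound ‖ContinuousLinearMap.fst ℝ ℝ ℝ‖ ?_)
      filter_upwards with w
      rw [norm_smul, norm_norm, mul_comm]
    · have := o2.norm_right.smul_isBigO
        (isBigO_refl (fun _ => ContinuousLinearMap.snd ℝ ℝ ℝ) (𝓝 (0 : ℝ × ℝ)))
      refine this.trans_isBigO (IsBigO.of_bound ‖ContinuousLinearMap.snd ℝ ℝ ℝ‖ ?_)
      filter_upwards with w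
      rw [norm_smul, norm_norm, mul_comm]
  · refine Or.inr ⟨(0, 1), by simp, ?_, isBigO_fderiv_of_pd (hdiff _) ?_ ?_⟩ <;>
      simp only [Prod.smul_mk, mul_zero, smul_eq_mul, mul_one]
    · refine isBigO_pow_of_iterate_deriv_eq_zero (contDiffAt_snd_line hf) fun j hj => ?_
      rw [iterate_deriv_snd]
      exact iterate_pd_eq_zero (h0 j hj)
    · refine isBigO_pow_of_iterate_deriv_eq_zero (contDiffAt_snd_line (contDiffAt_pd1 hf))
        fun j hj => ?_
      rw [iterate_deriv_snd]
      exact (comm j).symm.trans (iterate_pd_eq_zero (h1 j hj))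
    · refine isBigO_pow_of_iterate_deriv_eq_zero (contDiffAt_snd_line (contDiffAt_pd2 hf))
        fun j hj => ?_
      rw [iterate_deriv_snd]
      exact iterate_pd_eq_zero (h0 (j + 1) (by omega))
  · refine Or.inr ⟨(1, 0), by simp, ?_, isBigO_fderiv_of_pd (hdiff _) ?_ ?_⟩ <;>
      simp only [Prod.smul_mk, mul_zero, smul_eq_mul, mul_one]
    · refine isBigO_pow_of_iterate_deriv_eq_zero (contDiffAt_fst_line hf) fun j hj => ?_
      rw [iterate_deriv_fst]
      exact iterate_pd_eq_zero (h0 j hj)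
    · refine isBigO_pow_of_iterate_deriv_eq_zero (contDiffAt_fst_line (contDiffAt_pd1 hf))
        fun j hj => ?_
      rw [iterate_deriv_fst]
      exact iterate_pd_eq_zero (h0 (j + 1) (by omega))
    · refine isBigO_pow_of_iterate_deriv_eq_zero (contDiffAt_fst_line (contDiffAt_pd2 hf))
        fun j hj => ?_
      rw [iterate_deriv_fst]
      exact iterate_pd_eq_zero (h1 j hj)

end KingGraph

namespace KingGraph

open Asymptotics

/-! ### Local coordinates and heights -/

theorem LocalCoord.zero_mem_target (y : LocalCoord) : (0 : ℝ × ℝ) ∈ y.chart.target := by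
  have := y.chart.map_source y.zero_mem
  rwa [y.map_zero] at this

theorem LocalCoord.symm_zero (y : LocalCoord) : y.chart.symm 0 = 0 := by
  have := y.chart.left_inv y.zero_mem
  rwa [y.map_zero] at this

theorem LocalCoord.contDiffAt (y : LocalCoord) : ContDiffAt ℝ ∞ y.chart 0 :=
  y.smooth.contDiffAt (y.chart.open_source.mem_nhds y.zero_mem)

theorem LocalCoord.contDiffAt_symm (y : LocalCoord) : ContDiffAt ℝ ∞ y.chart.symm 0 :=
  y.smooth_symm.contDiffAt (y.chart.open_target.mem_nhds y.zero_mem_target)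

theorem LocalCoord.contDiffAt_express (y : LocalCoord) {f : ℝ × ℝ → ℝ}
    (hf : ContDiffAt ℝ ∞ f 0) : ContDiffAt ℝ ∞ (y.express f) 0 :=
  ContDiffAt.comp 0 (by rwa [y.symm_zero]) y.contDiffAt_symm

theorem LocalCoord.fderiv_express (y : LocalCoord) {f : ℝ × ℝ → ℝ} (hf : ContDiffAt ℝ ∞ f 0) :
    ∀ᶠ w in 𝓝 0, fderiv ℝ f w =
      (fderiv ℝ (y.express f) (y.chart w)).comp (fderiv ℝ y.chart w) := by
  have ht : Tendsto y.chart (𝓝 0) (𝓝 0) := by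
    have := y.contDiffAt.continuousAt.tendsto
    rwa [y.map_zero] at this
  filter_upwards [y.chart.open_source.mem_nhds y.zero_mem,
    ht.eventually (eventually_differentiableAt (y.contDiffAt_express hf)),
    eventually_differentiableAt y.contDiffAt] with w hw h1 h2
  have h3 := h1.hasFDerivAt.comp w h2.hasFDerivAt
  refine (h3.congr_of_eventuallyEq ?_).fderiv
  filter_upwards [y.chart.open_source.mem_nhds hw] with z hz
  simp only [Function.comp, LocalCoord.express, y.chart.left_inv hz]

/-- A germ whose Newton distance in some coordinates exceeds that of `x ^ 2 + y ^ (k + 1)` either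
has no quadratic part, or vanishes together with its differential to high order along a regular
curve. -/
theorem exists_curve_of_lt_newtonDistance {f : ℝ × ℝ → ℝ} (hf : ContDiffAt ℝ ∞ f 0)
    (y : LocalCoord) {k : ℕ} (hk : 1 ≤ k)
    (h : ((2 * (k + 1) / (k + 3) : ℝ) : EReal) < newtonDistance (y.express f)) :
    (fun w => fderiv ℝ f w) =o[𝓝 0] (fun w => w) ∨
    ∃ γ : ℝ → ℝ × ℝ, ContDiffAt ℝ ∞ γ 0 ∧ γ 0 = 0 ∧ deriv γ 0 ≠ 0 ∧
      (fun t : ℝ => f (γ t)) =O[𝓝 0] (fun t : ℝ => t ^ (k + 2)) ∧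
      (fun t : ℝ => fderiv ℝ f (γ t)) =O[𝓝 0] (fun t : ℝ => t ^ ((k + 1) / 2 + 1)) := by
  have hbd : (fun w => fderiv ℝ y.chart w) =O[𝓝 0] (fun _ => (1 : ℝ)) :=
    ((y.contDiffAt.fderiv_right (m := ∞) (by simp)).continuousAt.tendsto).isBigO_one ℝ
  -- By the chain rule the differential of `f` is that of `y.express f` composed with the
  -- differential of the chart, which is bounded near the origin; hence orders of vanishing carry
  -- over.
  have hcomp : ∀ {α : Type} {l : Filter α} (A B : α → (ℝ × ℝ) →L[ℝ] ℝ)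
      (C : α → (ℝ × ℝ) →L[ℝ] (ℝ × ℝ)), (∀ᶠ x in l, A x = (B x).comp (C x)) →
      C =O[l] (fun _ => (1 : ℝ)) → A =O[l] B := by
    intro α l A B C hA hC
    have h1 : A =O[l] fun x => ‖B x‖ * ‖C x‖ := IsBigO.of_bound 1 (by
      filter_upwards [hA] with x hx
      rw [hx, one_mul]
      exact ((B x).opNorm_comp_le (C x)).trans (le_abs_self _))
    refine h1.trans ?_
    have h2 : (fun x => ‖B x‖ * ‖C x‖) =O[l] (fun x => ‖B x‖ * 1) :=
      (isBigO_refl _ _).mul hC.norm_left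
    simpa using h2
  rcases vanishing_of_lt_newtonDistance (y.contDiffAt_express hf) hk h with h0 | ⟨v, hv, h1, h2⟩
  · left
    have ht : Tendsto y.chart (𝓝 0) (𝓝 0) := by
      have := y.contDiffAt.continuousAt.tendsto
      rwa [y.map_zero] at this
    refine (hcomp _ _ _ (y.fderiv_express hf) hbd).trans_isLittleO ?_
    refine (h0.comp_tendsto ht).trans_isBigO ?_
    have := (y.contDiffAt.differentiableAt (by simp)).isBigO_sub
    simp only [y.map_zero, sub_zero] at this
    exact this
  · right
    have hl : ContDiffAt ℝ ∞ (fun t : ℝ => t • v) 0 := by fun_prop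
    have hγ : ContDiffAt ℝ ∞ (fun t : ℝ => y.chart.symm (t • v)) 0 :=
      ContDiffAt.comp 0 (by simpa using y.contDiffAt_symm) hl
    have hlt : Tendsto (fun t : ℝ => t • v) (𝓝 0) (𝓝 0) := by
      simpa using hl.continuousAt.tendsto
    have hγ0 : y.chart.symm ((0 : ℝ) • v) = 0 := by simp [y.symm_zero]
    have hγt : Tendsto (fun t : ℝ => y.chart.symm (t • v)) (𝓝 0) (𝓝 0) := by
      have := hγ.continuousAt.tendsto
      simp only [hγ0] at this
      exact this
    have hinv : ∀ᶠ t in 𝓝 (0 : ℝ), y.chart (y.chart.symm (t • v)) = t • v := by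
      filter_upwards [hlt.eventually (y.chart.open_target.mem_nhds y.zero_mem_target)] with t ht
        using y.chart.right_inv ht
    refine ⟨fun t => y.chart.symm (t • v), hγ, hγ0, ?_, h1, ?_⟩
    -- The chart carries the curve to `t • v`, so zero velocity would give `v = 0`.
    · intro h0
      have d1 := (hγ.differentiableAt (by simp)).hasDerivAt
      rw [h0] at d1
      have d2 : HasFDerivAt y.chart (fderiv ℝ y.chart 0) (y.chart.symm ((0 : ℝ) • v)) := by
        rw [hγ0]
        exact (y.contDiffAt.differentiableAt (by simp)).hasFDerivAt
      have d3 := HasFDerivAt.comp_hasDerivAt (0 : ℝ) d2 d1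
      have d4 : HasDerivAt (fun t : ℝ => t • v) v 0 := by
        simpa using (hasDerivAt_id (0 : ℝ)).smul_const v
      have d5 := d3.unique (d4.congr_of_eventuallyEq hinv)
      rw [map_zero] at d5
      exact hv d5.symm
    · refine IsBigO.trans (hcomp _ (fun t : ℝ => fderiv ℝ (y.express f) (t • v))
        (fun t => fderiv ℝ y.chart (y.chart.symm (t • v))) ?_ (hbd.comp_tendsto hγt)) h2
      filter_upwards [hγt.eventually (y.fderiv_express hf), hinv] with t e1 e2
      rw [e1, e2]

/-- The change of coordinates from `y₀` to `y`. -/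
def LocalCoord.change (y₀ y : LocalCoord) : LocalCoord where
  chart := y₀.chart.symm.trans y.chart
  zero_mem := by
    rw [OpenPartialHomeomorph.trans_source]
    exact ⟨y₀.zero_mem_target, by simpa [y₀.symm_zero] using y.zero_mem⟩
  map_zero := by simp [y₀.symm_zero, y.map_zero]
  smooth := by
    rw [OpenPartialHomeomorph.coe_trans, OpenPartialHomeomorph.trans_source]
    exact y.smooth.comp (y₀.smooth_symm.mono inter_subset_left) (fun _ hx => hx.2)
  smooth_symm := by
    rw [OpenPartialHomeomorph.coe_trans_symm, OpenPartialHomeomorph.trans_target]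
    exact y₀.smooth.comp (y.smooth_symm.mono inter_subset_left) (fun _ hx => hx.2)

/-- Every chart for `f` factors through `y₀`, so a bound for the normal form valid in all
coordinates bounds the height of `f`. -/
theorem LocalCoord.newtonDistance_change (y₀ y : LocalCoord) {f g : ℝ × ℝ → ℝ}
    (h : y₀.express f =ᶠ[𝓝 0] g) :
    newtonDistance ((y₀.change y).express g) = newtonDistance (y.express f) := by
  have h1 : Tendsto y.chart.symm (𝓝 0) (𝓝 0) := by
    have := y.contDiffAt_symm.continuousAt.tendsto
    rwa [y.symm_zero] at this
  have h2 : Tendsto y₀.chart (𝓝 0) (𝓝 0) := by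
    have := y₀.contDiffAt.continuousAt.tendsto
    rwa [y₀.map_zero] at this
  refine newtonDistance_congr ?_
  filter_upwards [h1.eventually (y₀.chart.open_source.mem_nhds y₀.zero_mem),
    (h2.comp h1).eventually h] with w hw1 hw2
  simp only [LocalCoord.express, Function.comp] at hw2
  simp only [LocalCoord.express, LocalCoord.change, OpenPartialHomeomorph.coe_trans_symm,
    OpenPartialHomeomorph.symm_symm, Function.comp]
  rw [← hw2, y₀.chart.left_inv hw1]

/-- The identity coordinates. -/
def LocalCoord.refl : LocalCoord where
  chart := OpenPartialHomeomorph.refl _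
  zero_mem := mem_univ _
  map_zero := rfl
  smooth := contDiffOn_id
  smooth_symm := contDiffOn_id

/-! ### Normal forms of type `A_k` -/

/-- The function `a x ^ 2 + b y ^ (k + 1)`. -/
def normalForm (a b : ℝ) (k : ℕ) : ℝ × ℝ → ℝ := fun z => a * z.1 ^ 2 + b * z.2 ^ (k + 1)

theorem contDiff_normalForm (a b : ℝ) (k : ℕ) : ContDiff ℝ ∞ (normalForm a b k) := by
  unfold normalForm
  fun_prop

theorem pd1_normalForm (a b : ℝ) (k : ℕ) : pd1 (normalForm a b k) = fun z => 2 * a * z.1 := by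
  ext z
  have h := ((hasDerivAt_pow 2 z.1).const_mul a).add_const (b * z.2 ^ (k + 1))
  refine h.deriv.trans ?_
  norm_num
  ring

/-- With weights `1 / 2` and `1 / (k + 1)` both monomials have weight `1`. Only exponents with `m <
2` and `n < k + 1` could have smaller weight, and their coefficients are derivatives of `b t ^ (k +
1)` or of zero. -/
theorem le_newtonDistance_normalForm (a b : ℝ) (k : ℕ) :
    ((2 * (k + 1) / (k + 3) : ℝ) : EReal) ≤ newtonDistance (normalForm a b k) := by
  have hsm := (contDiff_normalForm a b k).contDiffAt (x := 0)
  have key := le_newtonDistance (f := normalForm a b k) (α := 1 / 2) (β := 1 / (k + 1))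
    (by norm_num) (by positivity) ?_
  · convert key using 2
    field_simp
    ring
  intro m n hmn
  by_contra! hlt
  have hn0 : (0 : ℝ) ≤ 1 / (k + 1) * n := by positivity
  have hm : m < 2 := by
    by_contra! hm
    have : (2 : ℝ) ≤ m := by exact_mod_cast hm
    linarith
  have hn : n < k + 1 := by
    by_contra! hn
    have h1 : ((k : ℝ) + 1) ≤ n := by exact_mod_cast hn
    have h2 : 1 ≤ 1 / ((k : ℝ) + 1) * n := by
      rw [one_div_mul_eq_div, le_div_iff₀ (by positivity)]
      linarith
    have h3 : (0 : ℝ) ≤ m := by positivity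
    linarith
  refine hmn ?_
  have : pd1^[m] (pd2^[n] (normalForm a b k)) (0, 0) = 0 := by
    interval_cases m
    · have := congrFun (iterate_deriv_snd (normalForm a b k) 0 n) 0
      refine this.symm.trans (iterate_deriv_eq_zero_of_isBigO (contDiffAt_snd_line hsm) ?_ n hn)
      simpa [normalForm] using isBigO_const_mul_self b (fun t : ℝ => t ^ (k + 1)) (𝓝 0)
    · refine (pd1_iterate_pd2_comm n hsm).eq_of_nhds.trans ?_
      have := congrFun (iterate_deriv_snd (pd1 (normalForm a b k)) 0 n) 0
      refine this.symm.trans (iterate_deriv_eq_zero_of_isBigO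
        (contDiffAt_snd_line (contDiffAt_pd1 hsm)) ?_ n hn)
      simp only [pd1_normalForm, mul_zero]
      exact isBigO_zero _ _
  simp [taylorCoeff, this]

/-- The quotient `(v t / t) ^ n` tends to `v' ^ n` and is also `O(t)`. -/
theorem deriv_eq_zero_of_pow_isBigO {v : ℝ → ℝ} {v' : ℝ} {n : ℕ} (hv : HasDerivAt v v' 0)
    (h0 : v 0 = 0) (h : (fun t => v t ^ n) =O[𝓝 0] fun t : ℝ => t ^ (n + 1)) : v' = 0 := by
  have h1 : Tendsto (fun t : ℝ => (t⁻¹ * v t) ^ n) (𝓝[≠] 0) (𝓝 (v' ^ n)) := by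
    have := hasDerivAt_iff_tendsto_slope_zero.1 hv
    simp only [zero_add, h0, sub_zero, smul_eq_mul] at this
    exact this.pow n
  obtain ⟨C, hC⟩ := h.bound
  have h2 : Tendsto (fun t : ℝ => C * |t|) (𝓝[≠] 0) (𝓝 0) := by
    have : Continuous fun t : ℝ => C * |t| := by fun_prop
    simpa using (this.tendsto 0).mono_left nhdsWithin_le_nhds
  have h3 : Tendsto (fun t : ℝ => (t⁻¹ * v t) ^ n) (𝓝[≠] 0) (𝓝 0) := by
    refine squeeze_zero_norm' ?_ h2
    filter_upwards [hC.filter_mono nhdsWithin_le_nhds, self_mem_nhdsWithin] with t ht ht0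
    have hp : 0 < |t| ^ n := pow_pos (abs_pos.2 ht0) n
    rw [mul_pow, inv_pow, norm_mul, norm_inv, norm_pow t, inv_mul_le_iff₀ (by simpa using hp)]
    refine ht.trans_eq ?_
    rw [norm_pow, pow_succ, Real.norm_eq_abs]
    ring
  exact eq_zero_of_pow_eq_zero (tendsto_nhds_unique h1 h3)

theorem newtonDistance_express_normalForm_le {a b : ℝ} (ha : a ≠ 0) (hb : b ≠ 0) {k : ℕ}
    (hk : 1 ≤ k) (y : LocalCoord) :
    newtonDistance (y.express (normalForm a b k)) ≤ ((2 * (k + 1) / (k + 3) : ℝ) : EReal) := by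
  by_contra! hlt
  have hsm : ∀ z, ContDiffAt ℝ ∞ (normalForm a b k) z :=
    fun z => (contDiff_normalForm a b k).contDiffAt
  have hfd : ∀ z, fderiv ℝ (normalForm a b k) z (1, 0) = 2 * a * z.1 := fun z => by
    rw [← pd1_eq_fderiv ((hsm z).differentiableAt (by simp)), pd1_normalForm]
  have happly : ∀ L : (ℝ × ℝ) →L[ℝ] ℝ, ‖L (1, 0)‖ ≤ ‖L‖ := fun L => by
    simpa using L.le_opNorm (1, 0)
  rcases exists_curve_of_lt_newtonDistance (hsm 0) y hk hlt with h | ⟨γ, hγ, hγ0, hγ', h1, h2⟩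
  · have ht : Tendsto (fun t : ℝ => (t, (0 : ℝ))) (𝓝 0) (𝓝 0) :=
      (show Continuous fun t : ℝ => (t, (0 : ℝ)) by fun_prop).tendsto 0
    -- On the first axis the `x`-derivative is `2 a t`, which cannot be `o(t)`.
    have h3 : (fun t : ℝ => 2 * a * t) =o[𝓝 0] fun t : ℝ => t := by
      refine IsBigO.trans_isLittleO (IsBigO.of_bound 1 ?_) ((h.comp_tendsto ht).trans_isBigO
        (IsBigO.of_bound 1 ?_))
      · filter_upwards with t
        have := happly (fderiv ℝ (normalForm a b k) (t, 0))
        rw [hfd] at this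
        simpa using this
      · filter_upwards with t
        simp
    have h4 : HasDerivAt (fun t : ℝ => 2 * a * t) 0 0 := by
      rw [hasDerivAt_iff_isLittleO]
      simpa using h3
    have h5 : HasDerivAt (fun t : ℝ => 2 * a * t) (2 * a) 0 := by
      simpa using (hasDerivAt_id (0 : ℝ)).const_mul (2 * a)
    have := h5.unique h4
    exact ha (by linarith)
  · have hd := (hγ.differentiableAt (by simp)).hasDerivAt
    have hu : HasDerivAt (fun t => (γ t).1) (deriv γ 0).1 0 := hd.fst
    have hv : HasDerivAt (fun t => (γ t).2) (deriv γ 0).2 0 := hd.snd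
    have ou : (fun t => (γ t).1) =O[𝓝 0] fun t : ℝ => t ^ ((k + 1) / 2 + 1) := by
      refine IsBigO.trans ?_ h2
      refine IsBigO.of_bound ‖2 * a‖⁻¹ ?_
      filter_upwards with t
      have := happly (fderiv ℝ (normalForm a b k) (γ t))
      rw [hfd, norm_mul] at this
      rwa [le_inv_mul_iff₀ (norm_pos_iff.2 (mul_ne_zero two_ne_zero ha))]
    -- Twice `(k + 1) / 2 + 1` is at least `k + 2` even after rounding down, so the square term is
    -- absorbed and only the power of the second coordinate remains.
    have ou2 : (fun t => a * (γ t).1 ^ 2) =O[𝓝 0] fun t : ℝ => t ^ (k + 2) := by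
      refine ((ou.pow 2).const_mul_left a).trans ?_
      simp only [← pow_mul]
      exact pow_isBigO_pow (by omega)
    have ov : (fun t => (γ t).2 ^ (k + 1)) =O[𝓝 0] fun t : ℝ => t ^ (k + 1 + 1) := by
      have := (h1.sub ou2).const_mul_left b⁻¹
      refine this.congr_left fun t => ?_
      simp only [normalForm]
      field_simp
      ring
    have e1 := deriv_eq_zero_of_pow_isBigO (n := 1) hu (by simp [hγ0])
      (by simpa using ou.trans (pow_isBigO_pow (m := 2) (by omega)))
    have e2 := deriv_eq_zero_of_pow_isBigO hv (by simp [hγ0]) ov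
    exact hγ' (Prod.ext e1 e2)

theorem height_eq_of_isASingularity {k : ℕ} (hk : 1 ≤ k) {f : ℝ × ℝ → ℝ} {p : ℝ × ℝ}
    (h : IsASingularity k f p) : heightAt f p = ((2 * (k + 1) / (k + 3) : ℝ) : EReal) := by
  obtain ⟨y₀, a, b, ha, hb, h⟩ := h
  have ha0 : a ≠ 0 := by rcases ha with rfl | rfl <;> norm_num
  have hb0 : b ≠ 0 := by rcases hb with rfl | rfl <;> norm_num
  have he : y₀.express (germAt f p) =ᶠ[𝓝 0] normalForm a b k := h
  refine le_antisymm (iSup_le fun y => ?_) ?_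
  · rw [← y₀.newtonDistance_change y he]
    exact newtonDistance_express_normalForm_le ha0 hb0 hk _
  · refine (le_newtonDistance_normalForm a b k).trans ?_
    rw [← newtonDistance_congr he]
    exact le_iSup (fun y : LocalCoord => newtonDistance (y.express (germAt f p))) y₀

/-- The height of a germ at a critical point is at least `1`. -/
theorem one_le_height {f : ℝ × ℝ → ℝ} (h0 : f 0 = 0) (h1 : pd1 f 0 = 0) (h2 : pd2 f 0 = 0) :
    ((1 : ℝ) : EReal) ≤ height f := by
  have key := le_newtonDistance (f := f) (α := 1 / 2) (β := 1 / 2) (by norm_num) (by norm_num) ?_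
  · refine le_trans ?_ (key.trans
      (le_iSup (fun y : LocalCoord => newtonDistance (y.express f)) LocalCoord.refl))
    norm_num
  intro m n hmn
  by_contra! hlt
  have hlt' : m + n < 2 := by
    have : (m + n : ℝ) < 2 := by linarith
    exact_mod_cast this
  refine hmn ?_
  have : pd1^[m] (pd2^[n] f) 0 = 0 := by
    obtain ⟨rfl, rfl⟩ | ⟨rfl, rfl⟩ | ⟨rfl, rfl⟩ :
        (m = 0 ∧ n = 0) ∨ (m = 1 ∧ n = 0) ∨ (m = 0 ∧ n = 1) := by omega
    · exact h0
    · exact h1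
    · exact h2
  unfold taylorCoeff
  rw [show ((0, 0) : ℝ × ℝ) = 0 from rfl, this, zero_div]

end KingGraph

namespace KingGraph

open Asymptotics Real

/-! ### The algebra of degenerate points -/

/-- The kernel of the Hessian is transverse to the degeneracy curve at points off the symmetry
axes. -/
theorem no_common_zero {a b : ℝ} (ha : a ^ 2 < 1) (hb : b ^ 2 < 1)
    (hD : a * b * (1 + 2 * a) * (1 + 2 * b) = 4 * (1 - a ^ 2) * (1 - b ^ 2))
    (h1 : 2 * (1 - a ^ 2) * (8 * a + b + 4 * a * b + 2 * b ^ 2) +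
      a * (1 + 2 * b) * (8 * b + a + 4 * a * b + 2 * a ^ 2) = 0)
    (h2 : 2 * (1 - b ^ 2) * (8 * b + a + 4 * a * b + 2 * a ^ 2) +
      b * (1 + 2 * a) * (8 * a + b + 4 * a * b + 2 * b ^ 2) = 0) : False := by
  obtain ⟨ha1, ha2⟩ := abs_lt.1 ((sq_lt_one_iff_abs_lt_one a).1 ha)
  obtain ⟨hb1, hb2⟩ := abs_lt.1 ((sq_lt_one_iff_abs_lt_one b).1 hb)
  -- The difference of `h1` and `h2` is divisible by `a - b`, so the diagonal is treated separately.
  by_cases hab : a = b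
  · subst hab
    have e1 : a * ((2 * a + 3) * (a + 2)) = 0 := by linear_combination h1 / 3
    have e2 : a = 0 := by
      rcases mul_eq_zero.1 e1 with h | h
      · exact h
      · exact absurd h (mul_pos (by linarith) (by linarith)).ne'
    subst e2
    norm_num at hD
  obtain ⟨u, hu⟩ : ∃ u, u = a + b := ⟨_, rfl⟩
  obtain ⟨w, hw⟩ : ∃ w, w = a * b := ⟨_, rfl⟩
  have hT : 14 - 3 * u - 14 * u ^ 2 + 2 * w - 4 * u * w = 0 := by
    apply mul_left_cancel₀ (sub_ne_zero.2 hab)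
    rw [hu, hw]
    linear_combination h1 - h2
  have hwu : w * (7 - 2 * u) = 4 * (u ^ 2 - 1) := by
    rw [hu, hw]
    linear_combination -hD
  -- Elimination of `w` between `hT` and `hwu`. Positivity of `(1 ± a) (1 ± b)` then confines `u` to
  -- `(-2, -3/2)`, `(-1, 1/2)` or `(1, 2)`, and the cubic has constant sign on each: negative,
  -- positive, negative.
  have hc : 30 - 11 * u - 28 * u ^ 2 + 4 * u ^ 3 = 0 := by
    linear_combination (7 - 2 * u) / 3 * hT - (2 - 4 * u) / 3 * hwu
  have hu2 : u < 2 := by linarith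
  have hu2' : -2 < u := by linarith
  have hp : 0 < (1 + u) * (3 + 2 * u) := by
    have : 0 < (1 + a) * (1 + b) * (7 - 2 * u) :=
      mul_pos (mul_pos (by linarith) (by linarith)) (by linarith)
    have e : (1 + a) * (1 + b) * (7 - 2 * u) = (1 + u) * (3 + 2 * u) := by
      rw [show (1 + a) * (1 + b) = 1 + u + w by rw [hu, hw]; ring]
      linear_combination hwu
    linarith
  have hm : 0 < (1 - u) * (1 - 2 * u) := by
    have : 0 < (1 - a) * (1 - b) * (7 - 2 * u) :=
      mul_pos (mul_pos (by linarith) (by linarith)) (by linarith)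
    have e : (1 - a) * (1 - b) * (7 - 2 * u) = 3 * ((1 - u) * (1 - 2 * u)) := by
      rw [show (1 - a) * (1 - b) = 1 - u + w by rw [hu, hw]; ring]
      linear_combination hwu
    linarith
  have hsq := sq_nonneg u
  rcases lt_or_ge u (-1) with h | h
  · have h3 : u < -3 / 2 := by
      have := neg_of_mul_pos_right hp (by linarith)
      linarith
    have h4 : 9 / 4 ≤ u ^ 2 := by nlinarith
    have h5 : 0 ≤ u ^ 2 * (-u) := mul_nonneg hsq (by linarith)
    linarith
  · rcases lt_or_ge u 1 with h' | h'
    · have h3 : u < 1 / 2 := by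
        have := pos_of_mul_pos_right hm (by linarith)
        linarith
      have h4 : 0 ≤ (u + 1) * (1 / 2 - u) := mul_nonneg (by linarith) (by linarith)
      have h5 : 0 ≤ (u + 1) * (u - 1 / 2) ^ 2 := mul_nonneg (by linarith) (sq_nonneg _)
      linarith
    · have h4 : 0 ≤ u ^ 2 * (2 - u) := mul_nonneg hsq (by linarith)
      have h5 : 1 ≤ u ^ 2 := one_le_pow₀ h'
      linarith

/-- Here `a = ± 1`, so the Hessian is diagonal and can degenerate only if `b = 0` or `b = -1/2`. In
the latter case the second-order equation `f2` can be solved by a suitable acceleration `y'`; the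
third-order condition `e3` is what forces `y' = 0`. -/
theorem direction_eq_zero_of_sin_eq_zero {s σ a b x y x' y' : ℝ} (hs : s = 0)
    (hsa : s ^ 2 + a ^ 2 = 1) (hσb : σ ^ 2 + b ^ 2 = 1)
    (e1 : a * (1 + 2 * b) * x = 2 * s * σ * y) (f1 : b * (1 + 2 * a) * y = 2 * s * σ * x)
    (f2 : σ * (1 + 2 * a) * y ^ 2 + 4 * b * s * x * y + 2 * σ * a * x ^ 2 =
      b * (1 + 2 * a) * y' - 2 * s * σ * x')
    (e3 : y = 0 → 1 + 2 * b = 0 → 6 * a * σ * x * y' = 0) : x = 0 ∧ y = 0 := by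
  subst hs
  have ha : a ≠ 0 := by
    rintro rfl
    norm_num at hsa
  have ha' : 1 + 2 * a ≠ 0 := by
    intro h
    have : a = -1 / 2 := by linarith
    rw [this] at hsa
    norm_num at hsa
  by_cases hy : y = 0
  · subst hy
    refine ⟨?_, rfl⟩
    by_contra hx
    have hb : 1 + 2 * b = 0 := by simpa [ha, hx] using e1
    have hσ : σ ≠ 0 := by
      rintro rfl
      have : b = -1 / 2 := by linarith
      rw [this] at hσb
      norm_num at hσb
    have hy' : y' = 0 := by simpa [ha, hσ, hx] using e3 rfl hb
    rw [hy'] at f2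
    have : σ * a * x ^ 2 = 0 := by linear_combination f2 / 2
    simp [ha, hσ, hx] at this
  · exfalso
    have hb : b = 0 := by simpa [ha', hy] using f1
    subst hb
    have hσ : σ ≠ 0 := by
      rintro rfl
      norm_num at hσb
    have hx : x = 0 := by simpa [ha] using e1
    subst hx
    simp [ha', hσ, hy] at f2

/-- The `2`-jet conditions on a curve along which the gradient map is stationary to third order
have no solution with nonzero velocity `(x, y)` off the symmetry axes. -/
theorem direction_eq_zero_of_sin_ne_zero {s σ a b x y x' y' : ℝ} (hs : s ≠ 0) (hσ : σ ≠ 0)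
    (hsa : s ^ 2 + a ^ 2 = 1) (hσb : σ ^ 2 + b ^ 2 = 1)
    (e1 : a * (1 + 2 * b) * x = 2 * s * σ * y) (f1 : b * (1 + 2 * a) * y = 2 * s * σ * x)
    (e2 : s * (1 + 2 * b) * x ^ 2 + 4 * a * σ * y * x + 2 * s * b * y ^ 2 =
      a * (1 + 2 * b) * x' - 2 * s * σ * y')
    (f2 : σ * (1 + 2 * a) * y ^ 2 + 4 * b * s * x * y + 2 * σ * a * x ^ 2 =
      b * (1 + 2 * a) * y' - 2 * s * σ * x') : x = 0 ∧ y = 0 := by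
  by_cases hx : x = 0
  · subst hx
    refine ⟨rfl, ?_⟩
    simpa [hs, hσ] using e1
  have hy : y ≠ 0 := by
    rintro rfl
    simp [hs, hσ, hx] at f1
  exfalso
  -- Pairing the second-order equations with the velocity removes the accelerations, because the
  -- Hessian is symmetric and kills the velocity. What remains is the third derivative of `omega`
  -- along the velocity, up to a factor.
  have hC : s * (1 + 2 * b) * x ^ 3 + 6 * a * σ * x ^ 2 * y + 6 * s * b * x * y ^ 2 +
      σ * (1 + 2 * a) * y ^ 3 = 0 := by
    linear_combination x * e2 + y * f2 + x' * e1 + y' * f1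
  have hs2 : s ^ 2 = 1 - a ^ 2 := by linarith
  have hσ2 : σ ^ 2 = 1 - b ^ 2 := by linarith
  have hD : a * b * (1 + 2 * a) * (1 + 2 * b) = 4 * (1 - a ^ 2) * (1 - b ^ 2) := by
    rw [← hs2, ← hσ2]
    apply mul_right_cancel₀ (mul_ne_zero hx hy)
    linear_combination b * (1 + 2 * a) * y * e1 + 2 * s * σ * y * f1
  -- Up to a factor, the derivative of the Hessian determinant along the velocity: the kernel
  -- direction is tangent to the degeneracy curve.
  have hE : s * (8 * a + b + 4 * a * b + 2 * b ^ 2) * x +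
      σ * (8 * b + a + 4 * a * b + 2 * a ^ 2) * y = 0 := by
    apply mul_left_cancel₀ (pow_ne_zero 2 hx)
    linear_combination b * (1 + 2 * a) * hC +
      (σ * (1 + 2 * a) * y + 2 * b * s * x) * (x * e1 - y * f1) -
      4 * x * (a * σ * x + s * b * y) * f1 - 8 * s * a * x ^ 3 * hσ2 - 8 * σ * b * y * x ^ 2 * hs2
  -- The kernel equations eliminate one velocity component from `hE`, leaving relations between the
  -- cosines alone.
  have h1 := mul_right_cancel₀ hx (show (2 * (1 - a ^ 2) * (8 * a + b + 4 * a * b + 2 * b ^ 2) +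
      a * (1 + 2 * b) * (8 * b + a + 4 * a * b + 2 * a ^ 2)) * x = 0 * x by
    rw [← hs2]
    linear_combination 2 * s * hE + (8 * b + a + 4 * a * b + 2 * a ^ 2) * e1)
  have h2 := mul_right_cancel₀ hy (show (2 * (1 - b ^ 2) * (8 * b + a + 4 * a * b + 2 * a ^ 2) +
      b * (1 + 2 * a) * (8 * a + b + 4 * a * b + 2 * b ^ 2)) * y = 0 * y by
    rw [← hσ2]
    linear_combination 2 * σ * hE + (8 * a + b + 4 * a * b + 2 * b ^ 2) * f1)
  have ha : a ^ 2 < 1 := by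
    have : 0 < s ^ 2 := by positivity
    linarith
  have hb : b ^ 2 < 1 := by
    have : 0 < σ ^ 2 := by positivity
    linarith
  exact no_common_zero ha hb hD h1 h2

/-! ### Jets of the gradient map along a curve -/

theorem jets_sin_mul_cos {x y : ℝ → ℝ} (hx : ContDiffAt ℝ ∞ x 0) (hy : ContDiffAt ℝ ∞ y 0) :
    let s := sin (x 0)
    let a := cos (x 0)
    let σ := sin (y 0)
    let b := cos (y 0)
    let x1 := deriv x 0
    let y1 := deriv y 0
    let x2 := deriv (deriv x) 0
    let y2 := deriv (deriv y) 0
    let x3 := deriv (deriv (deriv x)) 0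
    let y3 := deriv (deriv (deriv y)) 0
    let F := fun t => sin (x t) * (1 + 2 * cos (y t))
    ContDiffAt ℝ ∞ F 0 ∧
    deriv^[1] F 0 = a * (1 + 2 * b) * x1 - 2 * s * σ * y1 ∧
    deriv^[2] F 0 = a * (1 + 2 * b) * x2 - 2 * s * σ * y2 -
      (s * (1 + 2 * b) * x1 ^ 2 + 4 * a * σ * y1 * x1 + 2 * s * b * y1 ^ 2) ∧
    deriv^[3] F 0 = a * (1 + 2 * b) * (x3 - x1 ^ 3) - 3 * s * (1 + 2 * b) * x1 * x2 +
      6 * s * σ * x1 ^ 2 * y1 + 2 * s * σ * y1 ^ 3 - 2 * s * σ * y3 - 6 * a * b * x1 * y1 ^ 2 -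
      6 * s * b * y1 * y2 - 6 * a * σ * (x2 * y1 + x1 * y2) := by
  intro s a σ b x1 y1 x2 y2 x3 y3 F
  have hx' := contDiffAt_deriv hx
  have hy' := contDiffAt_deriv hy
  have hx'' := contDiffAt_deriv hx'
  have hy'' := contDiffAt_deriv hy'
  have ev : ∀ {f : ℝ → ℝ}, ContDiffAt ℝ ∞ f 0 → ∀ᶠ t in 𝓝 0, HasDerivAt f (deriv f t) t :=
    fun hf => (eventually_differentiableAt hf).mono fun t ht => ht.hasDerivAt
  have d1 : deriv F =ᶠ[𝓝 0] fun t => cos (x t) * (1 + 2 * cos (y t)) * deriv x t -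
      2 * sin (x t) * sin (y t) * deriv y t := by
    filter_upwards [ev hx, ev hy] with t h1 h2
    refine HasDerivAt.deriv ?_
    have := h1.sin.mul ((h2.cos.const_mul 2).const_add 1)
    refine this.congr_deriv ?_
    ring
  have d2 : deriv (deriv F) =ᶠ[𝓝 0] fun t =>
      cos (x t) * (1 + 2 * cos (y t)) * deriv (deriv x) t -
      2 * sin (x t) * sin (y t) * deriv (deriv y) t -
      (sin (x t) * (1 + 2 * cos (y t)) * deriv x t ^ 2 +
        4 * cos (x t) * sin (y t) * deriv y t * deriv x t +
        2 * sin (x t) * cos (y t) * deriv y t ^ 2) := by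
    refine (d1.deriv).trans ?_
    filter_upwards [ev hx, ev hy, ev hx', ev hy'] with t h1 h2 h3 h4
    refine HasDerivAt.deriv ?_
    have := ((h1.cos.mul ((h2.cos.const_mul 2).const_add 1)).mul h3).sub
      (((h1.sin.const_mul 2).mul h2.sin).mul h4)
    refine this.congr_deriv ?_
    simp only [Pi.mul_apply]
    ring
  refine ⟨?_, ?_, ?_, ?_⟩
  · exact hx.sin.mul (contDiffAt_const.add (contDiffAt_const.mul hy.cos))
  · exact d1.eq_of_nhds
  · exact d2.eq_of_nhds
  · refine (d2.deriv_eq).trans ?_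
    have h1 := (ev hx).self_of_nhds
    have h2 := (ev hy).self_of_nhds
    have h3 := (ev hx').self_of_nhds
    have h4 := (ev hy').self_of_nhds
    have h5 := (ev hx'').self_of_nhds
    have h6 := (ev hy'').self_of_nhds
    refine HasDerivAt.deriv ?_
    have := (((h1.cos.mul ((h2.cos.const_mul 2).const_add 1)).mul h5).sub
      (((h1.sin.const_mul 2).mul h2.sin).mul h6)).sub
      ((((h1.sin.mul ((h2.cos.const_mul 2).const_add 1)).mul (h3.pow 2)).add
        ((((h1.cos.const_mul 4).mul h2.sin).mul h4).mul h3)).add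
        (((h1.sin.const_mul 2).mul h2.cos).mul (h4.pow 2)))
    refine this.congr_deriv ?_
    simp only [s, a, σ, b, x1, x2, x3, y1, y2, y3]
    norm_num
    ring

theorem iterate_deriv_succ_sub_const (f : ℝ → ℝ) (c : ℝ) (j : ℕ) :
    deriv^[j + 1] (fun t => f t - c) = deriv^[j + 1] f := by
  have : deriv (fun t => f t - c) = deriv f := by
    ext t
    exact deriv_sub_const c
  rw [Function.iterate_succ_apply, this, Function.iterate_succ_apply]

/-- The gradient map of the dispersion relation is not stationary to third order along any
regular curve. -/
theorem velocity_eq_zero {x y : ℝ → ℝ} {c d : ℝ} (hx : ContDiffAt ℝ ∞ x 0)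
    (hy : ContDiffAt ℝ ∞ y 0)
    (h1 : (fun t => sin (x t) * (1 + 2 * cos (y t)) - c) =O[𝓝 0] fun t : ℝ => t ^ 4)
    (h2 : (fun t => sin (y t) * (1 + 2 * cos (x t)) - d) =O[𝓝 0] fun t : ℝ => t ^ 4) :
    deriv x 0 = 0 ∧ deriv y 0 = 0 := by
  obtain ⟨hF, F1, F2, F3⟩ := jets_sin_mul_cos hx hy
  obtain ⟨hG, G1, G2, G3⟩ := jets_sin_mul_cos hy hx
  have zF := iterate_deriv_eq_zero_of_isBigO (hF.sub contDiffAt_const) h1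
  have zG := iterate_deriv_eq_zero_of_isBigO (hG.sub contDiffAt_const) h2
  have zF1 := zF 1 (by norm_num)
  have zF2 := zF 2 (by norm_num)
  have zF3 := zF 3 (by norm_num)
  have zG1 := zG 1 (by norm_num)
  have zG2 := zG 2 (by norm_num)
  have zG3 := zG 3 (by norm_num)
  rw [iterate_deriv_succ_sub_const] at zF1 zF2 zF3 zG1 zG2 zG3
  rw [zF1] at F1
  rw [zF2] at F2
  rw [zF3] at F3
  rw [zG1] at G1
  rw [zG2] at G2
  rw [zG3] at G3
  have px := sin_sq_add_cos_sq (x 0)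
  have py := sin_sq_add_cos_sq (y 0)
  by_cases hs : sin (x 0) = 0
  · refine direction_eq_zero_of_sin_eq_zero hs px py (by linear_combination -F1)
      (by linear_combination -G1) (x' := deriv (deriv x) 0) (y' := deriv (deriv y) 0)
      (by linear_combination G2) (fun h h' => ?_)
    rw [h, h', hs] at F3
    linear_combination F3
  by_cases hσ : sin (y 0) = 0
  · refine (direction_eq_zero_of_sin_eq_zero hσ py px (by linear_combination -G1)
      (by linear_combination -F1) (x' := deriv (deriv y) 0) (y' := deriv (deriv x) 0)
      (by linear_combination F2) (fun h h' => ?_)).symm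
    rw [h, h', hσ] at G3
    linear_combination G3
  · exact direction_eq_zero_of_sin_ne_zero hs hσ px py (by linear_combination -F1)
      (by linear_combination -G1) (x' := deriv (deriv x) 0) (y' := deriv (deriv y) 0)
      (by linear_combination F2) (by linear_combination G2)

end KingGraph

namespace KingGraph

open Asymptotics Real

/-! ### The phase of the King graph -/

theorem hasDerivAt_omega_fst (x y : ℝ) :
    HasDerivAt (fun t => omega (t, y)) (2 * (sin x * (1 + 2 * cos y))) x := by
  have h := (((((hasDerivAt_cos x).const_mul 2).const_sub 8).sub_const (2 * cos y)).sub
    (((hasDerivAt_id x).add_const y).cos.const_mul 2)).sub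
    (((hasDerivAt_id x).sub_const y).cos.const_mul 2)
  refine h.congr_deriv ?_
  simp only [id, sin_add, sin_sub]
  ring

theorem hasDerivAt_omega_snd (x y : ℝ) :
    HasDerivAt (fun t => omega (x, t)) (2 * (sin y * (1 + 2 * cos x))) y := by
  have h := ((((hasDerivAt_cos y).const_mul 2).const_sub (8 - 2 * cos x)).sub
    (((hasDerivAt_id y).const_add x).cos.const_mul 2)).sub
    (((hasDerivAt_id y).const_sub x).cos.const_mul 2)
  refine h.congr_deriv ?_
  simp only [id, sin_add, sin_sub]
  ring

theorem pd1_omega : pd1 omega = fun z => 2 * (sin z.1 * (1 + 2 * cos z.2)) :=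
  funext fun z => (hasDerivAt_omega_fst z.1 z.2).deriv

theorem pd2_omega : pd2 omega = fun z => 2 * (sin z.2 * (1 + 2 * cos z.1)) :=
  funext fun z => (hasDerivAt_omega_snd z.1 z.2).deriv

theorem det_hess_omega (p : ℝ × ℝ) : (hess omega p).det =
    4 * (cos p.1 * (1 + 2 * cos p.2) * (cos p.2 * (1 + 2 * cos p.1)) -
      4 * sin p.1 ^ 2 * sin p.2 ^ 2) := by
  have h11 : pd1 (pd1 omega) p = 2 * (cos p.1 * (1 + 2 * cos p.2)) := by
    rw [pd1_omega]
    exact (((hasDerivAt_sin p.1).mul_const (1 + 2 * cos p.2)).const_mul 2).deriv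
  have h22 : pd2 (pd2 omega) p = 2 * (cos p.2 * (1 + 2 * cos p.1)) := by
    rw [pd2_omega]
    exact (((hasDerivAt_sin p.2).mul_const (1 + 2 * cos p.1)).const_mul 2).deriv
  have h12 : pd1 (pd2 omega) p = 2 * (sin p.2 * (2 * -sin p.1)) := by
    rw [pd2_omega]
    exact (((((hasDerivAt_cos p.1).const_mul 2).const_add 1).const_mul (sin p.2)).const_mul 2).deriv
  have h21 : pd2 (pd1 omega) p = 2 * (sin p.1 * (2 * -sin p.2)) := by
    rw [pd1_omega]
    exact (((((hasDerivAt_cos p.2).const_mul 2).const_add 1).const_mul (sin p.1)).const_mul 2).deriv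
  rw [hess, Matrix.det_fin_two_of, h11, h22, h12, h21]
  ring

theorem contDiff_germAt_phase (p : ℝ × ℝ) : ContDiff ℝ ∞ (germAt (phase p) p) := by
  unfold germAt phase omega
  fun_prop

theorem pd1_germAt_phase (p : ℝ × ℝ) : pd1 (germAt (phase p) p) = fun z =>
    2 * (sin (p.1 + z.1) * (1 + 2 * cos (p.2 + z.2)) - sin p.1 * (1 + 2 * cos p.2)) := by
  ext z
  have h1 : HasDerivAt (fun t => p.1 + t) 1 z.1 := (hasDerivAt_id z.1).const_add p.1
  have h2 := (hasDerivAt_omega_fst (p.1 + z.1) (p.2 + z.2)).comp z.1 h1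
  have h3 := (h2.sub ((h1.mul_const (grad omega p).1).add_const
    ((p.2 + z.2) * (grad omega p).2))).sub_const (phase p p)
  refine h3.deriv.trans ?_
  simp only [grad, pd1_omega]
  ring

theorem pd2_germAt_phase (p : ℝ × ℝ) : pd2 (germAt (phase p) p) = fun z =>
    2 * (sin (p.2 + z.2) * (1 + 2 * cos (p.1 + z.1)) - sin p.2 * (1 + 2 * cos p.1)) := by
  ext z
  have h1 : HasDerivAt (fun t => p.2 + t) 1 z.2 := (hasDerivAt_id z.2).const_add p.2
  have h2 := (hasDerivAt_omega_snd (p.1 + z.1) (p.2 + z.2)).comp z.2 h1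
  have h3 := (h2.sub ((h1.mul_const (grad omega p).2).const_add
    ((p.1 + z.1) * (grad omega p).1))).sub_const (phase p p)
  refine h3.deriv.trans ?_
  simp only [grad, pd2_omega]
  ring

/-! ### Height bounds for the phase -/

theorem isBigO_gradient_map {p : ℝ × ℝ} {γ : ℝ → ℝ × ℝ} {n : ℕ}
    (h : (fun t => fderiv ℝ (germAt (phase p) p) (γ t)) =O[𝓝 0] fun t : ℝ => t ^ n) :
    ((fun t => sin (p.1 + (γ t).1) * (1 + 2 * cos (p.2 + (γ t).2)) -
        sin p.1 * (1 + 2 * cos p.2)) =O[𝓝 0] fun t : ℝ => t ^ n) ∧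
    ((fun t => sin (p.2 + (γ t).2) * (1 + 2 * cos (p.1 + (γ t).1)) -
        sin p.2 * (1 + 2 * cos p.1)) =O[𝓝 0] fun t : ℝ => t ^ n) := by
  have hd : ∀ z, DifferentiableAt ℝ (germAt (phase p) p) z := fun z =>
    (contDiff_germAt_phase p).contDiffAt.differentiableAt (by simp)
  constructor
  · refine IsBigO.trans (IsBigO.of_bound 1 ?_) h
    filter_upwards with t
    have h1 := (fderiv ℝ (germAt (phase p) p) (γ t)).le_opNorm (1, 0)
    rw [← pd1_eq_fderiv (hd _), pd1_germAt_phase, norm_mul] at h1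
    simp only [Prod.norm_mk, norm_one, norm_zero, Real.norm_ofNat] at h1
    norm_num at h1
    rw [Real.norm_eq_abs, one_mul]
    refine le_trans ?_ h1
    linarith [abs_nonneg (sin (p.1 + (γ t).1) * (1 + 2 * cos (p.2 + (γ t).2)) -
        sin p.1 * (1 + 2 * cos p.2))]
  · refine IsBigO.trans (IsBigO.of_bound 1 ?_) h
    filter_upwards with t
    have h1 := (fderiv ℝ (germAt (phase p) p) (γ t)).le_opNorm (0, 1)
    rw [← pd2_eq_fderiv (hd _), pd2_germAt_phase, norm_mul] at h1
    simp only [Prod.norm_mk, norm_one, norm_zero, Real.norm_ofNat] at h1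
    norm_num at h1
    rw [Real.norm_eq_abs, one_mul]
    refine le_trans ?_ h1
    linarith [abs_nonneg (sin (p.2 + (γ t).2) * (1 + 2 * cos (p.1 + (γ t).1)) -
        sin p.2 * (1 + 2 * cos p.1))]

/-- The Hessian of the phase never vanishes. -/
theorem not_fderiv_isLittleO (p : ℝ × ℝ) :
    ¬ (fun w => fderiv ℝ (germAt (phase p) p) w) =o[𝓝 0] (fun w => w) := by
  intro h
  have hd : ∀ z, DifferentiableAt ℝ (germAt (phase p) p) z := fun z =>
    (contDiff_germAt_phase p).contDiffAt.differentiableAt (by simp)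
  have key : ∀ (u v : ℝ × ℝ) (m : ℝ),
      HasDerivAt (fun t : ℝ => fderiv ℝ (germAt (phase p) p) (t • u) v) m 0 → m = 0 := by
    intro u v m hm
    have ht : Tendsto (fun t : ℝ => t • u) (𝓝 0) (𝓝 0) := by
      simpa using (show Continuous fun t : ℝ => t • u by fun_prop).tendsto 0
    have h0 : fderiv ℝ (germAt (phase p) p) 0 = 0 := by
      obtain ⟨C, hC⟩ := h.isBigO.bound
      simpa using hC.self_of_nhds
    have h3 : (fun t : ℝ => fderiv ℝ (germAt (phase p) p) (t • u) v) =o[𝓝 0] fun t : ℝ => t := by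
      refine IsBigO.trans_isLittleO (IsBigO.of_bound ‖v‖ ?_) ((h.comp_tendsto ht).trans_isBigO
        (IsBigO.of_bound ‖u‖ ?_))
      · filter_upwards with t
        rw [mul_comm]
        exact (fderiv ℝ (germAt (phase p) p) (t • u)).le_opNorm v
      · filter_upwards with t
        simp only [Function.comp, norm_smul]
        rw [mul_comm]
    refine hm.unique ?_
    rw [hasDerivAt_iff_isLittleO]
    simpa [h0] using h3
  have e1 := key (1, 0) (1, 0) (2 * (cos p.1 * (1 + 2 * cos p.2))) (by
    simp only [← pd1_eq_fderiv (hd _), pd1_germAt_phase]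
    have h1 : HasDerivAt (fun t : ℝ => p.1 + t) 1 0 := (hasDerivAt_id 0).const_add p.1
    simpa using ((h1.sin.mul_const (1 + 2 * cos p.2)).sub_const
      (sin p.1 * (1 + 2 * cos p.2))).const_mul 2)
  have e2 := key (0, 1) (0, 1) (2 * (cos p.2 * (1 + 2 * cos p.1))) (by
    simp only [← pd2_eq_fderiv (hd _), pd2_germAt_phase]
    have h1 : HasDerivAt (fun t : ℝ => p.2 + t) 1 0 := (hasDerivAt_id 0).const_add p.2
    simpa using ((h1.sin.mul_const (1 + 2 * cos p.1)).sub_const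
      (sin p.2 * (1 + 2 * cos p.1))).const_mul 2)
  have e3 := key (0, 1) (1, 0) (2 * (sin p.1 * (2 * -sin p.2))) (by
    simp only [← pd1_eq_fderiv (hd _), pd1_germAt_phase]
    have h1 : HasDerivAt (fun t : ℝ => p.2 + t) 1 0 := (hasDerivAt_id 0).const_add p.2
    simpa using ((((h1.cos.const_mul 2).const_add 1).const_mul (sin p.1)).sub_const
      (sin p.1 * (1 + 2 * cos p.2))).const_mul 2)
  have px := sin_sq_add_cos_sq p.1
  have py := sin_sq_add_cos_sq p.2
  -- If one sine vanishes, that cosine is `± 1`, while the diagonal entries force both cosines to be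
  -- `-1/2`.
  have aux : ∀ s a b : ℝ, s = 0 → s ^ 2 + a ^ 2 = 1 → a * (1 + 2 * b) = 0 →
      b * (1 + 2 * a) = 0 → False := by
    rintro s a b rfl h1 h2 h3
    have ha : a ≠ 0 := by
      rintro rfl
      norm_num at h1
    have hb : 1 + 2 * b = 0 := by simpa [ha] using h2
    have hb' : b = -1 / 2 := by linarith
    have ha' : a = -1 / 2 := by
      rw [hb'] at h3
      linarith
    rw [ha'] at h1
    norm_num at h1
  have e1' : cos p.1 * (1 + 2 * cos p.2) = 0 := by linarith
  have e2' : cos p.2 * (1 + 2 * cos p.1) = 0 := by linarith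
  have e3' : sin p.1 * sin p.2 = 0 := by linarith
  rcases mul_eq_zero.1 e3' with hs | hs
  · exact aux _ _ _ hs px e1' e2'
  · exact aux _ _ _ hs py e2' e1'

theorem heightAt_phase_le_of_forall_curve {p : ℝ × ℝ} {k : ℕ} (hk : 1 ≤ k)
    (h : ∀ x y : ℝ → ℝ, ContDiffAt ℝ ∞ x 0 → ContDiffAt ℝ ∞ y 0 → x 0 = p.1 → y 0 = p.2 →
      ((fun t => sin (x t) * (1 + 2 * cos (y t)) - sin p.1 * (1 + 2 * cos p.2)) =O[𝓝 0]
        fun t : ℝ => t ^ ((k + 1) / 2 + 1)) →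
      ((fun t => sin (y t) * (1 + 2 * cos (x t)) - sin p.2 * (1 + 2 * cos p.1)) =O[𝓝 0]
        fun t : ℝ => t ^ ((k + 1) / 2 + 1)) →
      deriv x 0 = 0 ∧ deriv y 0 = 0) :
    heightAt (phase p) p ≤ ((2 * (k + 1) / (k + 3) : ℝ) : EReal) := by
  refine iSup_le fun y => ?_
  by_contra! hlt
  rcases exists_curve_of_lt_newtonDistance (contDiff_germAt_phase p).contDiffAt y hk hlt with
    h0 | ⟨γ, hγ, hγ0, hγ', -, h2⟩
  · exact not_fderiv_isLittleO p h0
  obtain ⟨h3, h4⟩ := isBigO_gradient_map h2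
  obtain ⟨d1, d2⟩ := h (fun t => p.1 + (γ t).1) (fun t => p.2 + (γ t).2)
    (contDiffAt_const.add hγ.fst) (contDiffAt_const.add hγ.snd) (by simp [hγ0]) (by simp [hγ0])
    h3 h4
  have hd := (hγ.differentiableAt (by simp)).hasDerivAt
  have hu : HasDerivAt (fun t => (γ t).1) (deriv γ 0).1 0 := hd.fst
  have hv : HasDerivAt (fun t => (γ t).2) (deriv γ 0).2 0 := hd.snd
  exact hγ' (Prod.ext ((hu.const_add p.1).deriv.symm.trans d1)
    ((hv.const_add p.2).deriv.symm.trans d2))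

theorem heightAt_phase_lt_two (p : ℝ × ℝ) : heightAt (phase p) p < ((2 : ℝ) : EReal) := by
  -- The choice `k = 5` gives the order `4` required by `velocity_eq_zero` and the bound `3 / 2`.
  refine (heightAt_phase_le_of_forall_curve (k := 5) (by norm_num)
    fun x y hx hy _ _ h1 h2 => velocity_eq_zero hx hy h1 h2).trans_lt ?_
  rw [EReal.coe_lt_coe_iff]
  norm_num

theorem heightAt_phase_of_det_ne_zero {p : ℝ × ℝ} (hp : (hess omega p).det ≠ 0) :
    heightAt (phase p) p = ((1 : ℝ) : EReal) := by
  refine le_antisymm ?_ (one_le_height (by simp [germAt]) (by simp [pd1_germAt_phase])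
    (by simp [pd2_germAt_phase]))
  refine (heightAt_phase_le_of_forall_curve (k := 1) le_rfl
    fun x y hx hy hx0 hy0 h1 h2 => ?_).trans_eq (by norm_num)
  obtain ⟨hF, F1, -, -⟩ := jets_sin_mul_cos hx hy
  obtain ⟨hG, G1, -, -⟩ := jets_sin_mul_cos hy hx
  have zF := iterate_deriv_eq_zero_of_isBigO (hF.sub contDiffAt_const) h1 1 (by norm_num)
  have zG := iterate_deriv_eq_zero_of_isBigO (hG.sub contDiffAt_const) h2 1 (by norm_num)
  rw [iterate_deriv_succ_sub_const] at zF zG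
  rw [zF, hx0, hy0] at F1
  rw [zG, hx0, hy0] at G1
  rw [det_hess_omega] at hp
  constructor
  -- Cramer's rule for the Hessian applied to the velocity.
  · refine (mul_eq_zero.1 (?_ : _ * deriv x 0 = 0)).resolve_left hp
    linear_combination -4 * (cos p.2 * (1 + 2 * cos p.1)) * F1 - 8 * sin p.1 * sin p.2 * G1
  · refine (mul_eq_zero.1 (?_ : _ * deriv y 0 = 0)).resolve_left hp
    linear_combination -4 * (cos p.1 * (1 + 2 * cos p.2)) * G1 - 8 * sin p.1 * sin p.2 * F1

end KingGraph

theorem proposition2p4 :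
    (∀ p ∈ KingGraph.Sigma1, KingGraph.heightAt (KingGraph.phase p) p = ((1 : ℝ) : EReal)) ∧
    (∀ p ∈ KingGraph.Sigma2, KingGraph.heightAt (KingGraph.phase p) p = ((6 / 5 : ℝ) : EReal)) ∧
    (∀ p ∈ KingGraph.Sigma3, KingGraph.heightAt (KingGraph.phase p) p = ((4 / 3 : ℝ) : EReal)) ∧
    (∀ p ∈ KingGraph.square,
      KingGraph.heightAt (KingGraph.phase p) p < ((2 : ℝ) : EReal) ∧
      KingGraph.varchenkoExponentAt (KingGraph.phase p) p = 0) := by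
  refine ⟨fun p hp => KingGraph.heightAt_phase_of_det_ne_zero hp.2, fun p hp => ?_, fun p hp => ?_,
    fun p _ => ⟨KingGraph.heightAt_phase_lt_two p, ?_⟩⟩
  · rw [KingGraph.height_eq_of_isASingularity (by norm_num) hp.2]
    norm_num
  · rw [KingGraph.height_eq_of_isASingularity (by norm_num) hp.2]
    norm_num
  · exact if_neg fun h => (KingGraph.heightAt_phase_lt_two p).not_ge h.2
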